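/- Let $\mathbf k$ be a field of characteristic zero and $V$ a finite-dimensional $\mathbb Z$-graded vector space over $\mathbf k$; the Koszul sign rule is used throughout, and $\downarrow V$ is the desuspension, $(\downarrow V)_i=V_{i+1}$. An $\mathsf{Ass}_\infty$-structure $\Gamma$ on $V$ is a family of maps $\mu_n:V^{\otimes n}\to V$ of degree $2-n$, $n\ge 1$, with $$\sum_{r+l+t=n,\ l\ge 1}(-1)^{r+lt}\,\mu_{r+1+t}\circ(1^{\otimes r}\otimes\mu_l\otimes 1^{\otimes t})=0\qquad(n\ge 1).$$ For $p,q\ge 1$ let $\zeta$ and $\xi$ be the cyclic permutations of the first $p$ and of the last $q$ of $p+q$ inputs, acting on maps with Koszul signs, let $\mathrm{Tr}_{p+1}(\mu_{p+q+1}):V^{\otimes p+q}\to\mathbf k$ be the graded trace (supertrace) of $\mu_{p+q+1}$ over its $(p+1)$-st input, i.e. the supertrace of $x\mapsto(-1)^{|x|(|w_1|+\dots+|w_q|)}\mu_{p+q+1}(v_1,\dots,v_p,x,w_1,\dots,w_q)$, and put $$\Gamma_{p,q}:=\sum_{i=0}^{p-1}\sum_{j=0}^{q-1}(-1)^{i(p+1)+j(q+1)}\,\zeta^i\xi^j\,\mathrm{Tr}_{p+1}(\mu_{p+q+1}).$$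 An $\mathsf{Ass}_\infty^\circlearrowright$-structure on $V$ extending $\Gamma$ (an extension of $\Gamma$ to a representation of the minimal wheeled resolution $\mathsf{Ass}_\infty^\circlearrowright$ of $\mathsf{Ass}$) consists of $\Gamma$ and maps $\mu_{p,q}:V^{\otimes p}\otimes V^{\otimes q}\to\mathbf k$ of degree $-p-q$, $p,q\ge1$, with $\zeta\mu_{p,q}=(-1)^{p+1}\mu_{p,q}$ and $\xi\mu_{p,q}=(-1)^{q+1}\mu_{p,q}$, such that for all $p,q\ge 1$ $$-(-1)^{p+q}\sum_{s=0}^{p+q-1}\mu_{p,q}\circ(1^{\otimes s}\otimes\mu_1\otimes1^{\otimes p+q-1-s})=\Gamma_{p,q}+\sum_{i=0}^{p-1}\big((-1)^{p+1}\zeta\big)^i\sum_{k=2}^{p}(-1)^{k(p+q)}\mu_{p-k+1,q}\circ(\mu_k\otimes 1^{\otimes p+q-k})$$ $$\qquad+\sum_{j=0}^{q-1}\big((-1)^{q+1}\xi\big)^j\sum_{k=2}^{q}(-1)^{p+k+qk+1}\mu_{p,q-k+1}\circ(1^{\otimes p}\otimes\mu_k\otimes1^{\otimes q-k}).$$ Let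 $$\mathit{Cyc}^n(V,\mathbf k):=\prod_{p,q\ge1}\mathrm{Hom}_n\big(((\downarrow V)^{\otimes p})_{C_p}\otimes((\downarrow V)^{\otimes q})_{C_q},\mathbf k\big),$$ where $C_p$, $C_q$ are the cyclic groups permuting the factors. Let $b_n:(\downarrow V)^{\otimes n}\to\,\downarrow V$ be the map of degree $1$ given by $b_n(\downarrow v_1,\dots,\downarrow v_n)=(-1)^{\sum_i(n-i)|v_i|}\downarrow\mu_n(v_1,\dots,v_n)$. The differential $\delta_\Gamma:\mathit{Cyc}^n\to\mathit{Cyc}^{n+1}$ is the action of $\Gamma=\{b_n\}$: $\delta_\Gamma x$ is $-(-1)^n$ times the sum of all compositions of $x$ with one $b_k$, $k\ge1$, applied to $k$ cyclically consecutive inputs from one of the two blocks. Let $$\Gamma^\circlearrowright:=\Big\{(\downarrow v_1,\dots,\downarrow v_{p+q})\mapsto(-1)^{p+\sum_i(p+q-i)|v_i|}\,\Gamma_{p,q}(v_1,\dots,v_{p+q})\Big\}_{p,q\ge1}.$$ Then $\Gamma^\circlearrowright\in\mathit{Cyc}^1(V,\mathbf k)$ and $\delta_\Gamma\Gamma^\circlearrowright=0$,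 so that the cyclic characteristic class $[\Gamma^\circlearrowright]\in H^1(\mathit{Cyc}^\bullet(V,\mathbf k),\delta_\Gamma)$ is defined; and $\Gamma$ can be extended to an $\mathsf{Ass}_\infty^\circlearrowright$-structure on $V$ if and only if $[\Gamma^\circlearrowright]=0$. -/

import Mathlib

/-! Homotopy associative algebras on a finite dimensional graded vector space, their wheeled
extensions, and the cyclic cochain complex.

A `ℤ`-graded vector space is a vector space `V` with a decomposition `𝒱 : ℤ → Submodule k V`.
Operations with `n` inputs are multilinear maps on `Fin n → V`. All differentials raise the degree
by one and the Koszul sign rule is in force. Koszul signs only depend on the parities of the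
inputs, so they are introduced by splitting every input into its even and its odd part. -/

namespace WheeledAss

open scoped BigOperators

noncomputable section

/-! ### Koszul signs -/

/-- The sign `(-1) ^ a` of a parity. -/
def sgn (a : ZMod 2) : ℤ := if a = 0 then 1 else -1

/-- The Koszul sign of the rearrangement of `v 0 ⊗ ⋯ ⊗ v (n-1)` into
`v (σ 0) ⊗ ⋯ ⊗ v (σ (n-1))`, where `v i` has parity `ε i`. -/
def koszulSign {n : ℕ} (σ : Equiv.Perm (Fin n)) (ε : Fin n → ZMod 2) : ℤ :=
  ∏ i : Fin n, ∏ j : Fin n, if i < j ∧ σ j < σ i then sgn (ε (σ i) * ε (σ j)) else 1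

section Graded

variable {k V W : Type*} [Field k] [AddCommGroup V] [Module k V] [AddCommGroup W] [Module k W]
variable (𝒱 : ℤ → Submodule k V) [DirectSum.Decomposition 𝒱]

/-- The projection of `V` onto the sum of its homogeneous components of degree parity `a`. -/
def parityPart (a : ZMod 2) : V →ₗ[k] V :=
  (DirectSum.toModule k ℤ V fun d : ℤ => if (d : ZMod 2) = a then (𝒱 d).subtype else 0) ∘ₗ
    (DirectSum.decomposeLinearEquiv 𝒱).toLinearMap

/-- Multiplication of a multilinear map by a sign depending on the parities of the inputs: on
homogeneous inputs `v i` of parities `ε i` the value is `s ε • f v`. -/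
def signTwist {ι : Type*} [Fintype ι] [DecidableEq ι] (s : (ι → ZMod 2) → ℤ) :
    MultilinearMap k (fun _ : ι => V) W →ₗ[k] MultilinearMap k (fun _ : ι => V) W :=
  ∑ ε : ι → ZMod 2, s ε • MultilinearMap.compLinearMapₗ (fun i => parityPart 𝒱 (ε i))

/-- `v ↦ ± f (v ∘ σ)` with the Koszul sign of the rearrangement. Here `c = 0` means that the inputs
carry their degrees in `V`, and `c = 1` that they carry their degrees in the desuspension `↓V`,
which are smaller by one. -/
def permute (c : ZMod 2) {n : ℕ} (σ : Equiv.Perm (Fin n)) :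
    MultilinearMap k (fun _ : Fin n => V) W →ₗ[k] MultilinearMap k (fun _ : Fin n => V) W :=
  signTwist 𝒱 (fun ε => koszulSign σ (fun i => ε i + c)) ∘ₗ
    (MultilinearMap.domDomCongrLinearEquiv k k V W σ).toLinearMap

/-- The list of inputs `v 0, …, v (r-1), g (v r, …, v (r+l-1)), v (r+l), …`. -/
def plug {M N l : ℕ} (h : M + 1 = N + l) (r : ℕ) (hr : r < N)
    (g : MultilinearMap k (fun _ : Fin l => V) V) (v : Fin M → V) (i : Fin N) : V :=
  if h₁ : i.1 < r then v ⟨i.1, by omega⟩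
  else if h₂ : i.1 = r then g (fun j => v ⟨r + j.1, by omega⟩)
  else v ⟨i.1 + l - 1, by omega⟩

theorem plug_update {M N l : ℕ} (h : M + 1 = N + l) (r : ℕ) (hr : r < N)
    (g : MultilinearMap k (fun _ : Fin l => V) V) (v : Fin M → V) (m : Fin M) :
    ∃ (i : Fin N) (L : V →ₗ[k] V), ∀ x,
      plug h r hr g (Function.update v m x) = Function.update (plug h r hr g v) i (L x) := by
  rcases lt_or_ge m.1 r with h₁ | h₁
  · refine ⟨⟨m.1, by omega⟩, LinearMap.id, fun x => funext fun i => ?_⟩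
    rcases eq_or_ne i ⟨m.1, by omega⟩ with rfl | hi
    · simp [plug, h₁]
    · have hi' : i.1 ≠ m.1 := fun e => hi (Fin.ext e)
      rw [Function.update_of_ne hi]
      unfold plug
      split_ifs with h₂ h₃
      · exact Function.update_of_ne (fun e => hi' (congrArg Fin.val e)) _ _
      · congr 1
        funext j
        exact Function.update_of_ne (fun e => by have := congrArg Fin.val e; simp at this; omega) _ _
      · exact Function.update_of_ne (fun e => by have := congrArg Fin.val e; simp at this; omega) _ _
  · rcases lt_or_ge m.1 (r + l) with h₂ | h₂
    · refine ⟨⟨r, hr⟩, g.toLinearMap (fun j => v ⟨r + j.1, by omega⟩) ⟨m.1 - r, by omega⟩,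
        fun x => funext fun i => ?_⟩
      rcases eq_or_ne i ⟨r, hr⟩ with rfl | hi
      · simp only [plug, lt_irrefl, dite_false, dite_true, Function.update_self,
          MultilinearMap.toLinearMap_apply]
        congr 1
        funext j
        rcases eq_or_ne j ⟨m.1 - r, by omega⟩ with rfl | hj
        · have e : (⟨r + (m.1 - r), by omega⟩ : Fin M) = m := Fin.ext (by simp; omega)
          simp [e]
        · rw [Function.update_of_ne hj, Function.update_of_ne]
          intro e
          apply hj
          have := congrArg Fin.val e
          simp at this
          exact Fin.ext (by simp; omega)
      · have hi' : i.1 ≠ r := fun e => hi (Fin.ext e)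
        rw [Function.update_of_ne hi]
        unfold plug
        split_ifs with h₃
        · exact Function.update_of_ne
            (fun e => by have := congrArg Fin.val e; simp at this; omega) _ _
        · exact Function.update_of_ne
            (fun e => by have := congrArg Fin.val e; simp at this; omega) _ _
    · refine ⟨⟨m.1 + 1 - l, by omega⟩, LinearMap.id, fun x => funext fun i => ?_⟩
      rcases eq_or_ne i ⟨m.1 + 1 - l, by omega⟩ with rfl | hi
      · have e : (⟨m.1 + 1 - l + l - 1, by omega⟩ : Fin M) = m := Fin.ext (by simp; omega)
        have h₃ : ¬ m.1 + 1 - l < r := by omega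
        have h₄ : ¬ m.1 + 1 - l = r := by omega
        simp [plug, h₃, h₄, e]
      · have hi' : i.1 ≠ m.1 + 1 - l := fun e => hi (Fin.ext e)
        rw [Function.update_of_ne hi]
        unfold plug
        split_ifs with h₃ h₄
        · exact Function.update_of_ne
            (fun e => by have := congrArg Fin.val e; simp at this; omega) _ _
        · congr 1
          funext j
          exact Function.update_of_ne
            (fun e => by have := congrArg Fin.val e; simp at this; omega) _ _
        · exact Function.update_of_ne
            (fun e => by have := congrArg Fin.val e; simp at this; omega) _ _

/-- Composition without signs,
`v ↦ f (v 0, …, v (r-1), g (v r, …, v (r+l-1)), v (r+l), …, v (M-1))`, linear in `f`. -/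
def insertPlain {M N l : ℕ} (h : M + 1 = N + l) (r : ℕ) (hr : r < N)
    (g : MultilinearMap k (fun _ : Fin l => V) V) :
    MultilinearMap k (fun _ : Fin N => V) W →ₗ[k] MultilinearMap k (fun _ : Fin M => V) W where
  toFun f :=
    { toFun := fun v => f (plug h r hr g v)
      map_update_add' := by
        intro inst v m x y
        obtain rfl : inst = instDecidableEqFin M := Subsingleton.elim _ _
        obtain ⟨i, L, hL⟩ := plug_update h r hr g v m
        simp only [hL, map_add, MultilinearMap.map_update_add]
      map_update_smul' := by
        intro inst v m a x
        obtain rfl : inst = instDecidableEqFin M := Subsingleton.elim _ _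
        obtain ⟨i, L, hL⟩ := plug_update h r hr g v m
        simp only [hL, map_smul, MultilinearMap.map_update_smul] }
  map_add' _ _ := rfl
  map_smul' _ _ := rfl

/-- The composition `f ∘ (1 ⊗ ⋯ ⊗ 1 ⊗ g ⊗ 1 ⊗ ⋯ ⊗ 1)` with `r` identities on the left, for `g` of
parity `e`. Its Koszul sign comes from `g` passing the first `r` inputs; `c` is as in `permute`. -/
def insertAt (c e : ZMod 2) {M N l : ℕ} (h : M + 1 = N + l) (r : ℕ) (hr : r < N)
    (g : MultilinearMap k (fun _ : Fin l => V) V) :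
    MultilinearMap k (fun _ : Fin N => V) W →ₗ[k] MultilinearMap k (fun _ : Fin M => V) W :=
  signTwist 𝒱 (fun ε => sgn (e * ∑ i : Fin M, if i.1 < r then ε i + c else 0)) ∘ₗ
    insertPlain h r hr g

/-- The passage between operations on `V` and operations on `↓V`: the operation on `↓V` takes
`↓v₁ ⊗ ⋯ ⊗ ↓vₙ` to `(-1) ^ ((n-1)|v₁| + (n-2)|v₂| + ⋯ + |vₙ₋₁|) f (v₁, …, vₙ)`, the sign being that
of moving the `n` arrows to the left. Elements of `↓V` are written as elements of `V`. -/
def desuspend {n : ℕ} :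
    MultilinearMap k (fun _ : Fin n => V) W →ₗ[k] MultilinearMap k (fun _ : Fin n => V) W :=
  signTwist 𝒱 (fun ε => sgn (∑ i : Fin n, ((n - 1 - i.1 : ℕ) : ZMod 2) * ε i))

/-- The trace of `f` with respect to the input number `p`, in the sense of graded vector spaces:
the supertrace of the operator
`x ↦ (-1) ^ (|x| (|w₁| + |w₂| + ⋯)) f (v₁, …, v_p, x, w₁, w₂, …)`. -/
def gradedTrace {N : ℕ} (p : Fin (N + 1)) (f : MultilinearMap k (fun _ : Fin (N + 1) => V) V) :
    MultilinearMap k (fun _ : Fin N => V) k where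
  toFun v := LinearMap.trace k V
    ((signTwist 𝒱 (fun ε => sgn (ε p * (1 + ∑ j : Fin (N + 1), if p < j then ε j else 0)))
      f).toLinearMap (p.insertNth (0 : V) v) p)
  map_update_add' := by
    intro inst v m x y
    obtain rfl : inst = instDecidableEqFin N := Subsingleton.elim _ _
    rw [← map_add]
    congr 1
    ext z
    simp only [LinearMap.add_apply, MultilinearMap.toLinearMap_apply, Fin.insertNth_update,
      Function.update_comm (Fin.ne_succAbove p m).symm, MultilinearMap.map_update_add]
  map_update_smul' := by
    intro inst v m a x
    obtain rfl : inst = instDecidableEqFin N := Subsingleton.elim _ _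
    rw [← map_smul]
    congr 1
    ext z
    simp only [LinearMap.smul_apply, MultilinearMap.toLinearMap_apply, Fin.insertNth_update,
      Function.update_comm (Fin.ne_succAbove p m).symm, MultilinearMap.map_update_smul]

/-- A multilinear operation on `V` of degree `m`. -/
def IsHomogeneousOp {n : ℕ} (f : MultilinearMap k (fun _ : Fin n => V) V) (m : ℤ) : Prop :=
  ∀ (d : Fin n → ℤ) (v : Fin n → V), (∀ i, v i ∈ 𝒱 (d i)) → f v ∈ 𝒱 (∑ i, d i + m)

/-- A multilinear form of degree `m` on `V`, the ground field being in degree zero; with a shift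
`c` the inputs carry their degrees in `V` lowered by `c`, so `c = 1` is the case of forms
on `↓V`. -/
def IsHomogeneousForm (c : ℤ) {n : ℕ} (f : MultilinearMap k (fun _ : Fin n => V) k) (m : ℤ) :
    Prop :=
  ∀ (d : Fin n → ℤ) (v : Fin n → V), (∀ i, v i ∈ 𝒱 (d i)) → ∑ i, (d i - c) + m ≠ 0 → f v = 0

/-! ### Homotopy associative algebras and their wheeled extensions -/

/-- An `Ass_∞`-structure on a graded vector space: operations `μ n` of degree `2 - n` with
`n ≥ 1` inputs (`μ 1` is the differential) such that
`∑ (-1) ^ (r + l (n - r - l)) μ (n - l + 1) ∘ (1 ^ r ⊗ μ l ⊗ 1 ^ (n - r - l)) = 0` for all `n ≥ 1`.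
The summation variable `l` below is one less than this `l`. -/
structure AInfStructure where
  μ : (n : ℕ) → MultilinearMap k (fun _ : Fin n => V) V
  μ_zero : μ 0 = 0
  degree : ∀ n : ℕ, 1 ≤ n → IsHomogeneousOp 𝒱 (μ n) (2 - (n : ℤ))
  relation : ∀ n : ℕ, 1 ≤ n →
    ∑ l : Fin n, ∑ r : Fin (n - l.1),
      ((-1 : ℤ) ^ (r.1 + (l.1 + 1) * (n - r.1 - (l.1 + 1)))) •
        insertAt 𝒱 0 ((l.1 + 1 : ℕ) : ZMod 2) (M := n) (N := n - l.1) (l := l.1 + 1)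
          (by omega) r.1 r.2 (μ (l.1 + 1)) (μ (n - l.1)) = 0

/-- The cyclic permutation of the first `p` letters. -/
def zeta (p q : ℕ) : Equiv.Perm (Fin (p + q)) :=
  finSumFinEquiv.permCongr (Equiv.Perm.sumCongr (finRotate p) 1)

/-- The cyclic permutation of the last `q` letters. -/
def xi (p q : ℕ) : Equiv.Perm (Fin (p + q)) :=
  finSumFinEquiv.permCongr (Equiv.Perm.sumCongr 1 (finRotate q))

variable {𝒱}

/-- The skew-cyclized trace of the operations with respect to the `(p+1)`-st input,
`∑ᵢ ∑ⱼ (-1) ^ (i (p + 1) + j (q + 1)) ζⁱ ξʲ Tr_{p+1} (μ (p + q + 1))`. -/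
def AInfStructure.cycTrace (Γ : AInfStructure 𝒱) (p q : ℕ) :
    MultilinearMap k (fun _ : Fin (p + q) => V) k :=
  ∑ i : Fin p, ∑ j : Fin q, ((-1 : ℤ) ^ (i.1 * (p + 1) + j.1 * (q + 1))) •
    permute 𝒱 0 (zeta p q ^ i.1 * xi p q ^ j.1)
      (gradedTrace 𝒱 (⟨p, by omega⟩ : Fin (p + q + 1)) (Γ.μ (p + q + 1)))

variable (𝒱)

/-- An `Ass_∞^↻`-structure on a finite dimensional graded vector space, that is, a representation
of the dg wheeled properad `Ass_∞^↻` freely generated by planar `(1,n)`-corollas, `n ≥ 2`, and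
cyclically skew-symmetric planar `(0,p+q)`-corollas, `p, q ≥ 1`: an `Ass_∞`-structure together with
forms `θ p q` on `V^{⊗ p} ⊗ V^{⊗ q}` of degree `-p-q`, `p, q ≥ 1`, that are skew-symmetric under
cyclic permutations of the first `p` and of the last `q` inputs, and compatible with the
differential of `Ass_∞^↻`: the differential of `θ p q` in the endomorphism complex of `(V, μ 1)`,
which is `-(-1) ^ (p + q) θ p q ∘ μ 1`, is the value of the differential of the generator. -/
structure WheeledAInfStructure extends AInfStructure 𝒱 where
  θ : (p q : ℕ) → MultilinearMap k (fun _ : Fin (p + q) => V) k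
  θ_zero : ∀ p q : ℕ, p = 0 ∨ q = 0 → θ p q = 0
  θ_degree : ∀ p q : ℕ, 1 ≤ p → 1 ≤ q → IsHomogeneousForm 𝒱 0 (θ p q) (-((p : ℤ) + q))
  θ_zeta : ∀ p q : ℕ, 1 ≤ p → 1 ≤ q →
    permute 𝒱 0 (zeta p q) (θ p q) = ((-1 : ℤ) ^ (p + 1)) • θ p q
  θ_xi : ∀ p q : ℕ, 1 ≤ p → 1 ≤ q →
    permute 𝒱 0 (xi p q) (θ p q) = ((-1 : ℤ) ^ (q + 1)) • θ p q
  θ_differential : ∀ p q : ℕ, 1 ≤ p → 1 ≤ q →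
    -((-1 : ℤ) ^ (p + q)) • ∑ i : Fin (p + q),
        insertAt 𝒱 0 1 (M := p + q) (N := p + q) (l := 1) rfl i.1 i.2 (μ 1) (θ p q) =
      toAInfStructure.cycTrace p q +
      -- the sum over the arities `a + 2` of an operation inserted into the first block
      ∑ i : Fin p, ((-1 : ℤ) ^ (i.1 * (p + 1))) • permute 𝒱 0 (zeta p q ^ i.1)
        (∑ a : Fin (p - 1), ((-1 : ℤ) ^ ((a.1 + 2) * (p + q))) •
          insertAt 𝒱 0 ((a.1 + 2 : ℕ) : ZMod 2) (M := p + q) (N := p - 1 - a.1 + q) (l := a.1 + 2)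
            (by omega) 0 (by omega) (μ (a.1 + 2)) (θ (p - 1 - a.1) q)) +
      -- the sum over the arities `a + 2` of an operation inserted into the second block
      ∑ j : Fin q, ((-1 : ℤ) ^ (j.1 * (q + 1))) • permute 𝒱 0 (xi p q ^ j.1)
        (∑ a : Fin (q - 1), ((-1 : ℤ) ^ (p + (a.1 + 2) + q * (a.1 + 2) + 1)) •
          insertAt 𝒱 0 ((a.1 + 2 : ℕ) : ZMod 2) (M := p + q) (N := p + (q - 1 - a.1)) (l := a.1 + 2)
            (by omega) p (by omega) (μ (a.1 + 2)) (θ p (q - 1 - a.1)))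

/-! ### The cyclic complex -/

/-- Families of multilinear forms on `(↓V)^{⊗ p} ⊗ (↓V)^{⊗ q}`. -/
abbrev FormFamily (k V : Type*) [Field k] [AddCommGroup V] [Module k V] : Type _ :=
  (p q : ℕ) → MultilinearMap k (fun _ : Fin (p + q) => V) k

instance (k V : Type*) [Field k] [AddCommGroup V] [Module k V] :
    AddCommGroup (FormFamily k V) :=
  inferInstance

/-- `Cyc^n(V, k)`: the product over `p, q ≥ 1` of the spaces of forms of degree `n` on
`((↓V)^{⊗ p})_{C_p} ⊗ ((↓V)^{⊗ q})_{C_q}`, that is, of forms on `(↓V)^{⊗ p} ⊗ (↓V)^{⊗ q}` invariant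
under the cyclic permutations of both blocks. -/
def Cyc (n : ℤ) : Submodule k (FormFamily k V) where
  carrier := {x | ∀ p q : ℕ, (p = 0 ∨ q = 0 → x p q = 0) ∧
    IsHomogeneousForm 𝒱 1 (x p q) n ∧
    permute 𝒱 1 (zeta p q) (x p q) = x p q ∧ permute 𝒱 1 (xi p q) (x p q) = x p q}
  add_mem' := by
    intro x y hx hy p q
    obtain ⟨h₁, h₂, h₃, h₄⟩ := hx p q
    obtain ⟨g₁, g₂, g₃, g₄⟩ := hy p q
    refine ⟨fun h => ?_, fun d v hv hd => ?_, ?_, ?_⟩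
    · simp [h₁ h, g₁ h]
    · simp [h₂ d v hv hd, g₂ d v hv hd]
    · simp [h₃, g₃]
    · simp [h₄, g₄]
  zero_mem' := fun p q =>
    ⟨fun _ => rfl, fun _ _ _ _ => rfl, by simp, by simp⟩
  smul_mem' := by
    intro a x hx p q
    obtain ⟨h₁, h₂, h₃, h₄⟩ := hx p q
    refine ⟨fun h => ?_, fun d v hv hd => ?_, ?_, ?_⟩
    · simp [h₁ h]
    · simp [h₂ d v hv hd]
    · simp [h₃]
    · simp [h₄]

variable {𝒱}

/-- The Maurer-Cartan element of an `Ass_∞`-structure: its operations as operations of degree `1`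
on `↓V`. -/
def AInfStructure.mc (Γ : AInfStructure 𝒱) (n : ℕ) : MultilinearMap k (fun _ : Fin n => V) V :=
  desuspend 𝒱 (Γ.μ n)

/-- The differential `δ_Γ` on `Cyc^n(V, k)`, the action of the Maurer-Cartan element: `δ_Γ x` is
`-(-1) ^ n` times the sum of all compositions of `x` with an operation of `Γ` applied to any number
of cyclically consecutive inputs from one of the two blocks. In terms of cyclically invariant forms
these are the cyclic permutations of the compositions at the beginning of the block. -/
def AInfStructure.delta (Γ : AInfStructure 𝒱) (n : ℤ) : FormFamily k V →ₗ[k] FormFamily k V :=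
  LinearMap.pi fun p => LinearMap.pi fun q => (-(n.negOnePow : ℤ)) •
    (∑ a : Fin p, ∑ i : Fin p, permute 𝒱 1 (zeta p q ^ i.1) ∘ₗ
        insertAt 𝒱 1 1 (M := p + q) (N := p - a.1 + q) (l := a.1 + 1)
          (by omega) 0 (by omega) (Γ.mc (a.1 + 1)) ∘ₗ
        LinearMap.proj q ∘ₗ LinearMap.proj (p - a.1) +
      ∑ a : Fin q, ∑ j : Fin q, permute 𝒱 1 (xi p q ^ j.1) ∘ₗ
        insertAt 𝒱 1 1 (M := p + q) (N := p + (q - a.1)) (l := a.1 + 1)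
          (by omega) p (by omega) (Γ.mc (a.1 + 1)) ∘ₗ
        LinearMap.proj (q - a.1) ∘ₗ LinearMap.proj p)

/-- The cocycles in `Cyc^n(V, k)`. -/
def AInfStructure.cocycles (Γ : AInfStructure 𝒱) (n : ℤ) : Submodule k (FormFamily k V) :=
  Cyc 𝒱 n ⊓ LinearMap.ker (Γ.delta n)

/-- The coboundaries `δ_Γ (Cyc^{n-1}(V, k))`. -/
def AInfStructure.coboundaries (Γ : AInfStructure 𝒱) (n : ℤ) : Submodule k (FormFamily k V) :=
  (Cyc 𝒱 (n - 1)).map (Γ.delta (n - 1))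

/-- The cohomology `H^n(Cyc(V, k))`. -/
abbrev AInfStructure.Cohomology (Γ : AInfStructure 𝒱) (n : ℤ) : Type _ :=
  ↥(Γ.cocycles n) ⧸ (Γ.coboundaries n).submoduleOf (Γ.cocycles n)

/-- The cohomology class of a cocycle. -/
def AInfStructure.cohomologyClass (Γ : AInfStructure 𝒱) (n : ℤ) (x : FormFamily k V)
    (hx : x ∈ Γ.cocycles n) : Γ.Cohomology n :=
  Submodule.Quotient.mk ⟨x, hx⟩

/-- The family `Γ^↻`: the skew-cyclized traces of the operations, as forms on
`(↓V)^{⊗ p} ⊗ (↓V)^{⊗ q}`. The factor `(-1) ^ p` belongs to the identification of forms on `V` with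
forms on `↓V`; with it the graded trace of an operation on `V` becomes the graded trace of the
corresponding operation on `↓V`. -/
def AInfStructure.wheel (Γ : AInfStructure 𝒱) : FormFamily k V :=
  fun p q => ((-1 : ℤ) ^ p) • desuspend 𝒱 (Γ.cycTrace p q)

end Graded

end

end WheeledAss

namespace WheeledAss

open scoped BigOperators

noncomputable section

/-! ### Signs -/

/-! Everything is moved to `↓V`. There the operations become operations `Γ.op` of degree one whose
structure equation has only Koszul signs (`insertSum_op`), and skew-symmetry under cyclic
permutations becomes invariance. Maps are evaluated on lists of homogeneous elements: a cyclic
permutation of a block becomes `rho`, a sum over rotations becomes `cyc`, and signs become exponents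
in `ZMod 2`.

The family `Γ.wheel` is then the cyclic sum `dcyc`, over both blocks, of `Γ.loop`, the supertrace of
an operation over an input `x` standing between the blocks (`ev_wheel`). To see that it is a
cocycle, take the supertrace of the structure equation (`loop_relation`). Terms whose inner
operation misses `x` are insertions into one of the blocks; after cyclic summation they give the
differential of `Γ.wheel`, because insertions at the front of a cyclic sum produce, when summed
cyclically, all insertions (`cyc_prefixSum_cyc`). Terms whose inner operation contains `x` are
supertraces of a composite of two operations. Cyclicity of the trace makes these antisymmetric under
exchange of the two factors (`doubleLoop_swap`), and the exchange is a rotation of both blocks.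
Their cyclic sum equals its own negative, so it vanishes (`dcyc_doubleLoop`).

For the extension problem, `suspendForms` matches the families `θ` having the required degrees and
symmetries with the elements of `Cyc 𝒱 0`. In the differential of such an element, arity one gives
the differential of `θ` in the endomorphism complex and the higher arities give the two sums of
insertions (`delta_suspendForms`). The equation required of `θ` therefore says exactly that
`Γ.wheel` is the differential of `suspendForms 𝒱 θ` (`differential_iff`). -/

theorem sgn_zero : sgn 0 = 1 := rfl

theorem sgn_one : sgn 1 = -1 := rfl

theorem sgn_add (a b : ZMod 2) : sgn (a + b) = sgn a * sgn b := by
  revert a b; decide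

theorem sgn_mul_self (a : ZMod 2) : sgn a * sgn a = 1 := by
  revert a; decide

theorem sgn_natCast (n : ℕ) : sgn (n : ZMod 2) = (-1) ^ n := by
  induction n with
  | zero => rfl
  | succ n ih => rw [Nat.cast_succ, sgn_add, ih, pow_succ, sgn_one]

theorem sgn_sum {ι : Type*} (s : Finset ι) (f : ι → ZMod 2) :
    sgn (∑ i ∈ s, f i) = ∏ i ∈ s, sgn (f i) := by
  classical
  induction s using Finset.induction_on with
  | empty => rfl
  | insert a s ha ih => rw [Finset.sum_insert ha, Finset.prod_insert ha, sgn_add, ih]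

/-- Koszul signs are multiplicative along compositions of permutations. -/
theorem koszulSign_mul {n : ℕ} (σ τ : Equiv.Perm (Fin n)) (ε : Fin n → ZMod 2) :
    koszulSign (σ * τ) ε = koszulSign σ ε * koszulSign τ (ε ∘ σ) := by
  -- Regrouping by unordered pairs is needed because reindexing by `τ` does not preserve the order
  -- inside a pair.
  have key : ∀ h : Fin n → Fin n → ℤ, (∀ i, h i i = 1) →
      ∏ i, ∏ j, h i j = ∏ i, ∏ j, if i < j then h i j * h j i else 1 := by
    intro h h0
    have e1 : ∏ i, ∏ j, h i j =
        (∏ i, ∏ j, if i < j then h i j else 1) * ∏ i, ∏ j, if j < i then h i j else 1 := by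
      rw [← Finset.prod_mul_distrib]
      refine Finset.prod_congr rfl fun i _ => ?_
      rw [← Finset.prod_mul_distrib]
      refine Finset.prod_congr rfl fun j _ => ?_
      rcases lt_trichotomy i j with hij | rfl | hij
      · simp [hij, hij.le]
      · simp [h0]
      · simp [hij, hij.le]
    rw [e1, Finset.prod_comm (f := fun i j => if j < i then h i j else 1),
      ← Finset.prod_mul_distrib]
    refine Finset.prod_congr rfl fun i _ => ?_
    rw [← Finset.prod_mul_distrib]
    refine Finset.prod_congr rfl fun j _ => ?_
    split_ifs <;> simp
  have e2 : koszulSign σ ε = ∏ i, ∏ j,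
      if τ i < τ j ∧ σ (τ j) < σ (τ i) then sgn (ε (σ (τ i)) * ε (σ (τ j))) else 1 := by
    unfold koszulSign
    rw [← Equiv.prod_comp τ]
    refine Finset.prod_congr rfl fun i _ => ?_
    rw [← Equiv.prod_comp τ]
  rw [e2, key _ (by simp)]
  unfold koszulSign
  rw [← Finset.prod_mul_distrib]
  refine Finset.prod_congr rfl fun i _ => ?_
  rw [← Finset.prod_mul_distrib]
  refine Finset.prod_congr rfl fun j _ => ?_
  by_cases hij : i < j
  · have hτ : τ i ≠ τ j := fun h => hij.ne (τ.injective h)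
    have hσ : σ (τ i) ≠ σ (τ j) := fun h => hτ (σ.injective h)
    have hs := sgn_mul_self (ε (σ (τ i)) * ε (σ (τ j)))
    simp only [Equiv.Perm.coe_mul, Function.comp_apply, hij, true_and, if_true,
      mul_comm (ε (σ (τ j)))]
    -- A pair inverted by both permutations is not inverted by the product; its sign occurs twice
    -- and cancels by `hs`.
    rcases lt_or_gt_of_ne hτ with h1 | h1 <;> rcases lt_or_gt_of_ne hσ with h2 | h2 <;>
      simp [h1, h2, h1.not_gt, h2.not_gt, hs]
  · simp [hij]

section Graded

variable {k V W : Type*} [Field k] [AddCommGroup V] [Module k V] [AddCommGroup W] [Module k W]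
variable (𝒱 : ℤ → Submodule k V)

/-! ### Evaluation on lists of homogeneous elements -/

/-- A homogeneous element together with a degree. -/
structure Homog where
  deg : ℤ
  vec : V
  mem : vec ∈ 𝒱 deg

/-- The default entry serves as the out-of-range value of `entry` and as the placeholder in
`evLinear`. -/
instance : Inhabited (Homog 𝒱) := ⟨⟨0, 0, Submodule.zero_mem _⟩⟩

variable {𝒱}

/-- The `i`-th entry of a list of homogeneous elements. -/
def entry (l : List (Homog 𝒱)) (i : ℕ) : Homog 𝒱 := l.getD i default

@[simp] theorem entry_cons_zero (x : Homog 𝒱) (l : List (Homog 𝒱)) : entry (x :: l) 0 = x := rfl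

@[simp] theorem entry_cons_succ (x : Homog 𝒱) (l : List (Homog 𝒱)) (i : ℕ) :
    entry (x :: l) (i + 1) = entry l i := rfl

theorem entry_append_left (l l' : List (Homog 𝒱)) {i : ℕ} (h : i < l.length) :
    entry (l ++ l') i = entry l i := List.getD_append _ _ _ _ h

theorem entry_append_right (l l' : List (Homog 𝒱)) {i : ℕ} (h : l.length ≤ i) :
    entry (l ++ l') i = entry l' (i - l.length) := List.getD_append_right _ _ _ _ h

@[simp] theorem entry_ofFn {n : ℕ} (f : Fin n → Homog 𝒱) (i : Fin n) :
    entry (List.ofFn f) i.1 = f i := by simp [entry]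

/-- The value of a multilinear map on a list of homogeneous elements. -/
def ev {n : ℕ} (f : MultilinearMap k (fun _ : Fin n => V) W) (l : List (Homog 𝒱)) : W :=
  f fun i => (entry l i.1).vec

@[simp] theorem ev_zero {n : ℕ} (l : List (Homog 𝒱)) :
    ev (0 : MultilinearMap k (fun _ : Fin n => V) W) l = 0 := rfl

@[simp] theorem ev_add {n : ℕ} (f g : MultilinearMap k (fun _ : Fin n => V) W)
    (l : List (Homog 𝒱)) : ev (f + g) l = ev f l + ev g l := rfl

@[simp] theorem ev_neg {n : ℕ} (f : MultilinearMap k (fun _ : Fin n => V) W)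
    (l : List (Homog 𝒱)) : ev (-f) l = -ev f l := rfl

@[simp] theorem ev_zsmul {n : ℕ} (a : ℤ) (f : MultilinearMap k (fun _ : Fin n => V) W)
    (l : List (Homog 𝒱)) : ev (a • f) l = a • ev f l := rfl

@[simp] theorem ev_sum {n : ℕ} {ι : Type*} (s : Finset ι)
    (f : ι → MultilinearMap k (fun _ : Fin n => V) W) (l : List (Homog 𝒱)) :
    ev (∑ i ∈ s, f i) l = ∑ i ∈ s, ev (f i) l := by
  simp [ev]

/-- The sum of the parities of the entries of a list, shifted by `c`. -/
def parity (c : ZMod 2) (l : List (Homog 𝒱)) : ZMod 2 :=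
  (l.map fun x => (x.deg : ZMod 2) + c).sum

@[simp] theorem parity_nil (c : ZMod 2) : parity c ([] : List (Homog 𝒱)) = 0 := rfl

@[simp] theorem parity_cons (c : ZMod 2) (x : Homog 𝒱) (l : List (Homog 𝒱)) :
    parity c (x :: l) = x.deg + c + parity c l := by simp [parity]

@[simp] theorem parity_append (c : ZMod 2) (l l' : List (Homog 𝒱)) :
    parity c (l ++ l') = parity c l + parity c l' := by simp [parity]

theorem parity_one (l : List (Homog 𝒱)) : parity 1 l = parity 0 l + l.length := by
  induction l with
  | nil => simp
  | cons x l ih => simp [ih]; ring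

/-- The exponent of the sign in `desuspend`. -/
def arrowParity : List (Homog 𝒱) → ZMod 2
  | [] => 0
  | x :: l => l.length * x.deg + arrowParity l

theorem arrowParity_append (l l' : List (Homog 𝒱)) :
    arrowParity (l ++ l') = arrowParity l + l'.length * parity 0 l + arrowParity l' := by
  induction l with
  | nil => simp [arrowParity]
  | cons x l ih => simp [arrowParity, ih]; ring

/-- Replaces exponents summed over `Fin n` by functions recursive in the list, so that sign
identities become `ring` identities in `ZMod 2`. -/
theorem sum_entry_eq_parity (c : ZMod 2) {n : ℕ} (l l' : List (Homog 𝒱))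
    (h : l.length ≤ n) :
    (∑ i : Fin n, if i.1 < l.length then ((entry (l ++ l') i.1).deg : ZMod 2) + c else 0) =
      parity c l := by
  rw [Fin.sum_univ_eq_sum_range
    (fun i => if i < l.length then ((entry (l ++ l') i).deg : ZMod 2) + c else 0) n,
    ← Finset.sum_subset (s₁ := Finset.range l.length) (by simpa using h)
      (fun x _ hx => if_neg (by simpa using hx))]
  clear h
  induction l with
  | nil => simp
  | cons x l ih =>
    rw [List.length_cons, Finset.sum_range_succ', parity_cons, add_comm ((x.deg : ZMod 2) + c)]
    congr 1
    · rw [← ih]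
      refine Finset.sum_congr rfl fun i hi => ?_
      have hi' := Finset.mem_range.1 hi
      rw [if_pos hi', if_pos (by omega), List.cons_append, entry_cons_succ]

theorem sum_entry_eq_arrowParity {n : ℕ} (l : List (Homog 𝒱)) (h : l.length = n) :
    (∑ i : Fin n, ((n - 1 - i.1 : ℕ) : ZMod 2) * ((entry l i.1).deg : ZMod 2)) =
      arrowParity l := by
  subst h
  induction l with
  | nil => simp [arrowParity]
  | cons x l ih =>
    rw [List.length_cons, Fin.sum_univ_succ, arrowParity, ← ih]
    congr 1
    refine Finset.sum_congr rfl fun i _ => ?_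
    rw [Fin.val_succ, entry_cons_succ, Nat.add_sub_cancel, Nat.sub_add_eq,
      Nat.sub_right_comm]

variable [DirectSum.Decomposition 𝒱]

theorem parityPart_of_mem (a : ZMod 2) {d : ℤ} {v : V} (h : v ∈ 𝒱 d) :
    parityPart 𝒱 a v = if (d : ZMod 2) = a then v else 0 := by
  simp only [parityPart, LinearMap.comp_apply, LinearEquiv.coe_coe,
    DirectSum.decomposeLinearEquiv_apply, DirectSum.decompose_of_mem _ h]
  erw [DirectSum.toModule_lof]
  split_ifs <;> simp

theorem signTwist_apply_of_mem {ι : Type*} [Fintype ι] [DecidableEq ι] (s : (ι → ZMod 2) → ℤ)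
    (f : MultilinearMap k (fun _ : ι => V) W) (d : ι → ℤ) (v : ι → V)
    (hv : ∀ i, v i ∈ 𝒱 (d i)) :
    signTwist 𝒱 s f v = s (fun i => (d i : ZMod 2)) • f v := by
  simp only [signTwist, LinearMap.sum_apply, _root_.sum_apply, LinearMap.smul_apply,
    _root_.smul_apply]
  -- Only the parity pattern of the inputs themselves survives; any other pattern kills some input.
  rw [Finset.sum_eq_single (fun i => (d i : ZMod 2))]
  · change _ • (f.compLinearMap fun i => parityPart 𝒱 (d i : ZMod 2)) v = _
    simp [MultilinearMap.compLinearMap_apply, parityPart_of_mem _ (hv _)]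
  · intro ε _ hε
    obtain ⟨i, hi⟩ := Function.ne_iff.1 hε
    have : (f.compLinearMap fun i => parityPart 𝒱 (ε i)) v = 0 := by
      rw [MultilinearMap.compLinearMap_apply]
      refine f.map_coord_zero i ?_
      rw [parityPart_of_mem _ (hv i), if_neg (Ne.symm hi)]
    change _ • (f.compLinearMap fun i => parityPart 𝒱 (ε i)) v = 0
    rw [this, smul_zero]
  · simp

/-- Multilinear maps that agree on homogeneous elements are equal. -/
theorem multilinear_ext_homog {n : ℕ} {f g : MultilinearMap k (fun _ : Fin n => V) W}
    (h : ∀ l : List (Homog 𝒱), l.length = n → ev f l = ev g l) : f = g := by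
  -- Bases of the homogeneous components form a basis of `V` made of homogeneous vectors.
  let b := (DirectSum.Decomposition.isInternal 𝒱).collectedBasis
    (fun d => Module.Free.chooseBasis k (𝒱 d))
  refine Module.Basis.ext_multilinear (fun _ => b) fun v => ?_
  let l : List (Homog 𝒱) := List.ofFn fun i => ⟨(v i).1, b (v i),
    DirectSum.IsInternal.collectedBasis_mem _ _ _⟩
  have := h l (by simp [l])
  simpa [ev, l] using this

theorem linear_ext_homog {f g : V →ₗ[k] W} (h : ∀ x : Homog 𝒱, f x.vec = g x.vec) : f = g := by
  let b := (DirectSum.Decomposition.isInternal 𝒱).collectedBasis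
    (fun d => Module.Free.chooseBasis k (𝒱 d))
  exact b.ext fun i => h ⟨i.1, b i, DirectSum.IsInternal.collectedBasis_mem _ _ _⟩

theorem form_ext_homog {p q : ℕ} {f g : MultilinearMap k (fun _ : Fin (p + q) => V) W}
    (h : ∀ us ws : List (Homog 𝒱), us.length = p → ws.length = q →
      ev f (us ++ ws) = ev g (us ++ ws)) : f = g := by
  refine multilinear_ext_homog (𝒱 := 𝒱) fun l hl => ?_
  rw [← List.take_append_drop p l]
  exact h _ _ (by simp [hl]) (by simp [hl])

theorem ev_signTwist {n : ℕ} (s : (Fin n → ZMod 2) → ℤ)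
    (f : MultilinearMap k (fun _ : Fin n => V) W) (l : List (Homog 𝒱)) :
    ev (signTwist 𝒱 s f) l = s (fun i => ((entry l i.1).deg : ZMod 2)) • ev f l :=
  signTwist_apply_of_mem s f _ _ fun i => (entry l i.1).mem

theorem ev_desuspend {n : ℕ} (f : MultilinearMap k (fun _ : Fin n => V) W)
    (l : List (Homog 𝒱)) (h : l.length = n) :
    ev (desuspend 𝒱 f) l = sgn (arrowParity l) • ev f l := by
  rw [desuspend, ev_signTwist, sum_entry_eq_arrowParity l h]

theorem desuspend_desuspend {n : ℕ} (f : MultilinearMap k (fun _ : Fin n => V) W) :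
    desuspend 𝒱 (desuspend 𝒱 f) = f := by
  refine multilinear_ext_homog (𝒱 := 𝒱) fun l hl => ?_
  rw [ev_desuspend _ _ hl, ev_desuspend _ _ hl, smul_smul, sgn_mul_self, one_smul]

/-- The degree recorded in `y` is free: only the vector enters, and the sign depends on `l₁` alone.
This allows the output of an operation to be rescaled later. -/
theorem ev_insertAt (c e : ZMod 2) {M N l r : ℕ} (h : M + 1 = N + l) (hr : r < N)
    (g : MultilinearMap k (fun _ : Fin l => V) V) (f : MultilinearMap k (fun _ : Fin N => V) W)
    (l₁ l₂ l₃ : List (Homog 𝒱)) (h₁ : l₁.length = r) (h₂ : l₂.length = l)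
    (y : Homog 𝒱) (hy : y.vec = ev g l₂) :
    ev (insertAt 𝒱 c e h r hr g f) (l₁ ++ (l₂ ++ l₃)) =
      sgn (e * parity c l₁) • ev f (l₁ ++ y :: l₃) := by
  subst h₁ h₂
  rw [insertAt, LinearMap.comp_apply, ev_signTwist, sum_entry_eq_parity c l₁ _ (by omega)]
  congr 1
  simp only [ev, insertPlain, LinearMap.coe_mk, AddHom.coe_mk, MultilinearMap.coe_mk]
  congr 1
  funext i
  unfold plug
  split_ifs with h₁ h₂
  · simp [entry_append_left, h₁]
  · rw [h₂, entry_append_right _ _ le_rfl, Nat.sub_self, entry_cons_zero, hy, ev]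
    congr 1
    funext j
    simp only
    rw [entry_append_right _ _ (by omega), entry_append_left _ _ (by omega)]
    congr 2
    omega
  · simp only
    rw [entry_append_right _ _ (by omega), entry_append_right _ _ (by omega),
      entry_append_right _ _ (by omega)]
    obtain ⟨m, hm⟩ : ∃ m, i.1 - l₁.length = m + 1 := ⟨i.1 - l₁.length - 1, by omega⟩
    rw [hm, entry_cons_succ]
    congr 2
    omega

/-! ### Permutations -/

theorem ev_permute (c : ZMod 2) {n : ℕ} (σ : Equiv.Perm (Fin n))
    (f : MultilinearMap k (fun _ : Fin n => V) W) (l l' : List (Homog 𝒱))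
    (hl : ∀ i, entry l' i.1 = entry l (σ i).1) :
    ev (permute 𝒱 c σ f) l =
      koszulSign σ (fun i => ((entry l i.1).deg : ZMod 2) + c) • ev f l' := by
  rw [permute, LinearMap.comp_apply, ev_signTwist]
  congr 1
  simp [ev, hl, MultilinearMap.domDomCongrLinearEquiv]

theorem permute_mul (c : ZMod 2) {n : ℕ} (σ τ : Equiv.Perm (Fin n))
    (f : MultilinearMap k (fun _ : Fin n => V) W) :
    permute 𝒱 c (σ * τ) f = permute 𝒱 c σ (permute 𝒱 c τ f) := by
  refine multilinear_ext_homog (𝒱 := 𝒱) fun l hl => ?_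
  let m : List (Homog 𝒱) := List.ofFn fun i => entry l (σ i).1
  let m' : List (Homog 𝒱) := List.ofFn fun i => entry l (σ (τ i)).1
  have hm : ∀ i : Fin n, entry m i.1 = entry l (σ i).1 := by
    intro i; simp [m]
  have hm' : ∀ i : Fin n, entry m' i.1 = entry l (σ (τ i)).1 := by
    intro i; simp [m']
  rw [ev_permute c (σ * τ) f l m' hm', ev_permute c σ _ l m hm,
    ev_permute c τ f m m' (by intro i; rw [hm', hm]), smul_smul, koszulSign_mul]
  congr 3
  funext i
  simp only [Function.comp_apply]
  rw [hm]

theorem permute_one (c : ZMod 2) {n : ℕ} (f : MultilinearMap k (fun _ : Fin n => V) W) :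
    permute 𝒱 c 1 f = f := by
  refine multilinear_ext_homog (𝒱 := 𝒱) fun l hl => ?_
  rw [ev_permute c 1 f l l (fun i => rfl)]
  have : ∀ ε : Fin n → ZMod 2, koszulSign 1 ε = 1 := by
    intro ε
    refine Finset.prod_eq_one fun i _ => Finset.prod_eq_one fun j _ => if_neg ?_
    rintro ⟨h₁, h₂⟩
    exact lt_asymm h₁ h₂
  rw [this, one_smul]

/-- The sign of the cyclic rotation of the block of length `m + 1` that begins at `a`. -/
theorem koszulSign_rotate {n a m : ℕ} (h : a + m < n) (σ : Equiv.Perm (Fin n))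
    (h₁ : ∀ i, i.1 < a → σ i = i) (h₂ : ∀ i, a + m < i.1 → σ i = i)
    (h₃ : ∀ i, a ≤ i.1 → i.1 < a + m → (σ i).1 = i.1 + 1)
    (h₄ : (σ ⟨a + m, h⟩).1 = a) (ε : Fin n → ZMod 2) :
    koszulSign σ ε = sgn (ε ⟨a, by omega⟩ *
      ∑ i : Fin m, ε ⟨a + i.1 + 1, by omega⟩) := by
  have hσ : ∀ i, (σ i).1 = if i.1 < a then i.1 else if i.1 < a + m then i.1 + 1 else
      if i.1 = a + m then a else i.1 := by
    intro i
    split_ifs with g₁ g₂ g₃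
    · rw [h₁ i g₁]
    · rw [h₃ i (by omega) g₂]
    · obtain rfl : i = ⟨a + m, h⟩ := Fin.ext g₃
      exact h₄
    · rw [h₂ i (by omega)]
  have hσm := hσ ⟨a + m, h⟩
  -- The inversions of a rotation are exactly the pairs formed by the last position of the block and
  -- an earlier one, so the first entry passes each other entry once.
  have hinv : ∀ i j : Fin n, (i < j ∧ σ j < σ i) ↔ (j = ⟨a + m, h⟩ ∧ a ≤ i.1 ∧ i.1 < a + m) := by
    intro i j
    rw [Fin.lt_def, Fin.lt_def, hσ, hσ, Fin.ext_iff]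
    dsimp only
    split_ifs <;> omega
  have hs : σ ⟨a + m, h⟩ = ⟨a, by omega⟩ := Fin.ext h₄
  have step : ∀ i : Fin n,
      (∏ j : Fin n, if i < j ∧ σ j < σ i then sgn (ε (σ i) * ε (σ j)) else 1) =
      if a ≤ i.1 ∧ i.1 < a + m then sgn (ε (σ i) * ε ⟨a, by omega⟩) else 1 := by
    intro i
    rw [Finset.prod_eq_single ⟨a + m, h⟩, hs]
    · have := hinv i ⟨a + m, h⟩
      rw [hs] at this
      simp only [this, true_and]
    · intro j _ hj
      rw [if_neg]
      rw [hinv]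
      exact fun g => hj g.1
    · simp
  unfold koszulSign
  rw [Finset.prod_congr rfl fun i _ => step i, Finset.mul_sum, sgn_sum]
  let e : Fin m ↪ Fin n := ⟨fun i => ⟨a + i.1, by omega⟩, fun i j hij => by
    simp at hij; exact Fin.ext hij⟩
  have he : ∀ i, (e i).1 = a + i.1 := fun _ => rfl
  rw [← Finset.prod_subset (s₁ := Finset.univ.map e) (Finset.subset_univ _), Finset.prod_map]
  · refine Finset.prod_congr rfl fun i _ => ?_
    have : σ (e i) = ⟨a + i.1 + 1, by omega⟩ := by
      apply Fin.ext
      rw [h₃ (e i) (by rw [he]; omega) (by rw [he]; omega), he]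
    rw [if_pos (by rw [he]; omega), this, mul_comm]
  · intro i _ hi
    rw [if_neg]
    rintro ⟨g₁, g₂⟩
    apply hi
    simp only [Finset.mem_map, Finset.mem_univ, true_and]
    exact ⟨⟨i.1 - a, by omega⟩, Fin.ext (by rw [he]; dsimp only; omega)⟩

theorem ev_permute_rotate (c : ZMod 2) {n : ℕ} (σ : Equiv.Perm (Fin n))
    (f : MultilinearMap k (fun _ : Fin n => V) W) (l₁ l₂ l₃ : List (Homog 𝒱)) (x : Homog 𝒱)
    (h : (l₁ ++ x :: l₂ ++ l₃).length = n)
    (h₁ : ∀ i, i.1 < l₁.length → σ i = i) (h₂ : ∀ i, l₁.length + l₂.length < i.1 → σ i = i)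
    (h₃ : ∀ i, l₁.length ≤ i.1 → i.1 < l₁.length + l₂.length → (σ i).1 = i.1 + 1)
    (h₄ : ∀ i, i.1 = l₁.length + l₂.length → (σ i).1 = l₁.length) :
    ev (permute 𝒱 c σ f) (l₁ ++ x :: l₂ ++ l₃) =
      sgn ((x.deg + c) * parity c l₂) • ev f (l₁ ++ (l₂ ++ [x]) ++ l₃) := by
  have hn : l₁.length + l₂.length < n := by simp at h; omega
  rw [ev_permute c σ f _ (l₁ ++ (l₂ ++ [x]) ++ l₃), koszulSign_rotate hn σ h₁ h₂ h₃ (h₄ _ rfl)]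
  · congr 3
    · simp [entry_append_right]
    · rw [← sum_entry_eq_parity c (n := l₂.length) l₂ [] le_rfl]
      refine Finset.sum_congr rfl fun i _ => ?_
      simp only [Fin.is_lt, if_true, List.append_nil]
      rw [List.append_assoc, entry_append_right _ _ (by omega)]
      rw [show l₁.length + i.1 + 1 - l₁.length = i.1 + 1 by omega, List.cons_append,
        entry_cons_succ, entry_append_left _ _ i.2]
  · intro i
    rcases lt_or_ge i.1 l₁.length with g₁ | g₁
    · rw [h₁ i g₁, List.append_assoc, List.append_assoc, List.append_assoc,
        entry_append_left l₁ _ g₁, entry_append_left l₁ _ g₁]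
    rcases lt_trichotomy i.1 (l₁.length + l₂.length) with g₂ | g₂ | g₂
    · rw [h₃ i g₁ g₂, List.append_assoc, List.append_assoc, List.append_assoc,
        entry_append_right _ _ g₁, entry_append_right l₁ _ (by omega),
        entry_append_left _ _ (by omega),
        show i.1 + 1 - l₁.length = (i.1 - l₁.length) + 1 by omega,
        List.cons_append, entry_cons_succ, entry_append_left _ _ (by omega)]
    · rw [h₄ i g₂, List.append_assoc, List.append_assoc, List.append_assoc,
        entry_append_right _ _ g₁, entry_append_right l₁ _ le_rfl,
        entry_append_right _ _ (by omega),
        show i.1 - l₁.length - l₂.length = 0 by omega]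
      simp
    · rw [h₂ i g₂, entry_append_right _ _ (by simp; omega),
        entry_append_right _ _ (by simp; omega)]
      simp

theorem ev_permute_zeta (c : ZMod 2) {p q : ℕ}
    (f : MultilinearMap k (fun _ : Fin (p + q) => V) W) (us ws : List (Homog 𝒱)) (x : Homog 𝒱)
    (hu : (x :: us).length = p) (hw : ws.length = q) :
    ev (permute 𝒱 c (zeta p q) f) (x :: us ++ ws) =
      sgn ((x.deg + c) * parity c us) • ev f (us ++ [x] ++ ws) := by
  subst hu hw
  have key : ∀ i : Fin ((x :: us).length), ((zeta (x :: us).length ws.length) (Fin.castAdd _ i)) =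
      Fin.castAdd _ (finRotate _ i) := by
    intro i; simp [zeta]
  refine ev_permute_rotate c _ f [] us ws x (by simp; omega) (by simp) ?_ ?_ ?_
  · intro i hi
    obtain ⟨j, rfl⟩ : ∃ j, i = Fin.natAdd _ j :=
      ⟨⟨i.1 - (x :: us).length, by have := i.2; simp at hi this ⊢; omega⟩,
        Fin.ext (by simp at hi ⊢; omega)⟩
    simp [zeta]
  · intro i _ hi
    obtain ⟨j, rfl⟩ : ∃ j, i = Fin.castAdd _ j :=
      ⟨⟨i.1, by simp at hi ⊢; omega⟩, rfl⟩
    rw [key]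
    simp only [Fin.val_castAdd]
    exact coe_finRotate_of_ne_last (n := us.length) (fun h => by
      have := congrArg Fin.val h; simp at this hi; omega)
  · intro i hi
    obtain ⟨j, rfl⟩ : ∃ j, i = Fin.castAdd _ j :=
      ⟨⟨i.1, by simp at hi ⊢; omega⟩, rfl⟩
    rw [key]
    have : j = Fin.last us.length := Fin.ext (by simpa using hi)
    rw [this]
    simp

theorem ev_permute_xi (c : ZMod 2) {p q : ℕ}
    (f : MultilinearMap k (fun _ : Fin (p + q) => V) W) (us ws : List (Homog 𝒱)) (x : Homog 𝒱)
    (hu : us.length = p) (hw : (x :: ws).length = q) :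
    ev (permute 𝒱 c (xi p q) f) (us ++ x :: ws) =
      sgn ((x.deg + c) * parity c ws) • ev f (us ++ (ws ++ [x])) := by
  subst hu hw
  have key : ∀ i : Fin ((x :: ws).length), ((xi us.length (x :: ws).length) (Fin.natAdd _ i)) =
      Fin.natAdd _ (finRotate _ i) := by
    intro i; simp [xi]
  have := ev_permute_rotate c (xi us.length (x :: ws).length) f us ws [] x (by simp) ?_ ?_ ?_ ?_
  · simpa using this
  · intro i hi
    obtain ⟨j, rfl⟩ : ∃ j, i = Fin.castAdd _ j := ⟨⟨i.1, hi⟩, rfl⟩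
    simp [xi]
  · intro i hi
    have := i.2
    simp at this hi
    omega
  · intro i h₀ hi
    obtain ⟨j, rfl⟩ : ∃ j, i = Fin.natAdd _ j :=
      ⟨⟨i.1 - us.length, by have := i.2; simp at this ⊢; omega⟩, Fin.ext (by simp; omega)⟩
    rw [key]
    simp only [Fin.val_natAdd]
    rw [add_assoc]
    congr 1
    exact coe_finRotate_of_ne_last (n := ws.length) (fun h => by
      have := congrArg Fin.val h; simp at this hi; omega)
  · intro i hi
    obtain ⟨j, rfl⟩ : ∃ j, i = Fin.natAdd _ j :=
      ⟨⟨i.1 - us.length, by have := i.2; simp at this ⊢; omega⟩, Fin.ext (by simp; omega)⟩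
    rw [key]
    have : j = Fin.last ws.length := Fin.ext (by simpa using hi)
    rw [this]
    simp

end Graded

section Graded

variable {k V : Type*} [Field k] [AddCommGroup V] [Module k V]
variable {𝒱 : ℤ → Submodule k V}
variable {M M' : Type*} [AddCommGroup M] [AddCommGroup M']

/-! ### Rotations of lists -/

/-- The cyclic rotation of functions on lists, with Koszul signs. -/
def rho (c : ZMod 2) (g : List (Homog 𝒱) → M) : List (Homog 𝒱) → M
  | [] => g []
  | x :: t => sgn ((x.deg + c) * parity c t) • g (t ++ [x])

@[simp] theorem rho_nil (c : ZMod 2) (g : List (Homog 𝒱) → M) : rho c g [] = g [] := rfl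

theorem rho_cons (c : ZMod 2) (g : List (Homog 𝒱) → M) (x : Homog 𝒱) (t : List (Homog 𝒱)) :
    rho c g (x :: t) = sgn ((x.deg + c) * parity c t) • g (t ++ [x]) := rfl

theorem rho_pow_succ_apply (c : ZMod 2) (i : ℕ) (g : List (Homog 𝒱) → M) :
    (rho c)^[i + 1] g = rho c ((rho c)^[i] g) := Function.iterate_succ_apply' _ _ _

theorem rho_pow_succ_apply' (c : ZMod 2) (i : ℕ) (g : List (Homog 𝒱) → M) :
    (rho c)^[i + 1] g = (rho c)^[i] (rho c g) := rfl

/-- Each entry of `u` passes the rest of `u` and is later passed by it, so the signs internal to `u`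
cancel and only those of `u` against `u'` remain. -/
theorem rho_pow_append (c : ZMod 2) (g : List (Homog 𝒱) → M) (u u' : List (Homog 𝒱)) {i : ℕ}
    (hi : u.length = i) :
    (rho c)^[i] g (u ++ u') = sgn (parity c u * parity c u') • g (u' ++ u) := by
  subst hi
  induction u generalizing u' with
  | nil => simp [sgn_zero]
  | cons x u ih =>
    rw [List.length_cons, rho_pow_succ_apply, List.cons_append, rho_cons, List.append_assoc, ih,
      smul_smul, ← sgn_add]
    congr 2
    · simp
      have h2 : (2 : ZMod 2) = 0 := rfl
      linear_combination (parity c u * (x.deg + c)) * h2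
    · simp

theorem rho_pow_length (c : ZMod 2) (g : List (Homog 𝒱) → M) (l : List (Homog 𝒱)) :
    (rho c)^[l.length] g l = g l := by
  have := rho_pow_append c g l [] rfl
  simpa [sgn_zero] using this

/-- Rotation preserves length, so agreement in one length suffices; evaluations of a multilinear map
are meaningful only in its own arity. -/
theorem rho_pow_congr (c : ZMod 2) {g g' : List (Homog 𝒱) → M} {n : ℕ}
    (h : ∀ l, l.length = n → g l = g' l) (i : ℕ) (l : List (Homog 𝒱)) (hl : l.length = n) :
    (rho c)^[i] g l = (rho c)^[i] g' l := by
  induction i generalizing l with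
  | zero => exact h l hl
  | succ i ih =>
    rw [rho_pow_succ_apply, rho_pow_succ_apply]
    cases l with
    | nil => exact ih _ hl
    | cons x t => rw [rho_cons, rho_cons, ih _ (by simpa using hl)]

/-- Additivity statements follow from this by collecting several functions into one with values in a
product and taking for `φ` a sum of projections. -/
theorem rho_pow_map (c : ZMod 2) (φ : M →+ M') (g : List (Homog 𝒱) → M) (i : ℕ)
    (l : List (Homog 𝒱)) : (rho c)^[i] (fun l => φ (g l)) l = φ ((rho c)^[i] g l) := by
  induction i generalizing l with
  | zero => rfl
  | succ i ih =>
    rw [rho_pow_succ_apply, rho_pow_succ_apply]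
    cases l with
    | nil => exact ih _
    | cons x t => rw [rho_cons, rho_cons, ih, map_zsmul]

theorem rho_pow_smul (c : ZMod 2) (s : List (Homog 𝒱) → ℤ) (hs : ∀ x t, s (t ++ [x]) = s (x :: t))
    (g : List (Homog 𝒱) → M) (i : ℕ) (l : List (Homog 𝒱)) :
    (rho c)^[i] (fun l => s l • g l) l = s l • (rho c)^[i] g l := by
  induction i generalizing l with
  | zero => rfl
  | succ i ih =>
    rw [rho_pow_succ_apply, rho_pow_succ_apply]
    cases l with
    | nil => exact ih _
    | cons x t => rw [rho_cons, rho_cons, ih, hs, smul_comm]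

/-- The sum over all cyclic rotations, for the degrees in the desuspension. -/
def cyc (g : List (Homog 𝒱) → M) (l : List (Homog 𝒱)) : M :=
  ∑ i ∈ Finset.range l.length, (rho 1)^[i] g l

@[simp] theorem cyc_nil (g : List (Homog 𝒱) → M) : cyc g [] = 0 := rfl

theorem cyc_congr {g g' : List (Homog 𝒱) → M} {n : ℕ} (h : ∀ l, l.length = n → g l = g' l)
    (l : List (Homog 𝒱)) (hl : l.length = n) : cyc g l = cyc g' l :=
  Finset.sum_congr rfl fun i _ => rho_pow_congr 1 h i l hl

theorem cyc_map (φ : M →+ M') (g : List (Homog 𝒱) → M) (l : List (Homog 𝒱)) :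
    cyc (fun l => φ (g l)) l = φ (cyc g l) := by
  simp [cyc, rho_pow_map]

theorem cyc_neg (g : List (Homog 𝒱) → M) (l : List (Homog 𝒱)) :
    cyc (fun l => -g l) l = -cyc g l :=
  cyc_map (-AddMonoidHom.id M) g l

theorem cyc_sum {ι : Type*} (s : Finset ι) (g : ι → List (Homog 𝒱) → M)
    (l : List (Homog 𝒱)) :
    cyc (fun l => ∑ j ∈ s, g j l) l = ∑ j ∈ s, cyc (g j) l := by
  have h₁ := cyc_map (∑ j ∈ s, Pi.evalAddMonoidHom (fun _ : ι => M) j) (fun l j => g j l) l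
  simp only [AddMonoidHom.finsetSum_apply, Pi.evalAddMonoidHom_apply] at h₁
  rw [h₁]
  exact Finset.sum_congr rfl fun j _ =>
    (cyc_map (Pi.evalAddMonoidHom (fun _ : ι => M) j) (fun l j => g j l) l).symm

theorem cyc_add (g g' : List (Homog 𝒱) → M) (l : List (Homog 𝒱)) :
    cyc (fun l => g l + g' l) l = cyc g l + cyc g' l := by
  have h₁ := cyc_map (AddMonoidHom.fst M M + AddMonoidHom.snd M M) (fun l => (g l, g' l)) l
  rw [AddMonoidHom.add_apply, ← cyc_map, ← cyc_map] at h₁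
  exact h₁

theorem cyc_smul (s : List (Homog 𝒱) → ℤ) (hs : ∀ x t, s (t ++ [x]) = s (x :: t))
    (g : List (Homog 𝒱) → M) (l : List (Homog 𝒱)) :
    cyc (fun l => s l • g l) l = s l • cyc g l := by
  simp [cyc, rho_pow_smul 1 s hs, Finset.smul_sum]

/-- A full turn is the identity, so shifting the exponent only permutes the summands. The invariance
of `cyc` on both sides, `cyc_rho_pow` and `rho_cyc`, rests on this. -/
theorem sum_rho_pow_succ (g : List (Homog 𝒱) → M) (l : List (Homog 𝒱)) :
    ∑ i ∈ Finset.range l.length, (rho 1)^[i + 1] g l = cyc g l := by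
  have h₁ := Finset.sum_range_succ (fun i => (rho 1)^[i] g l) l.length
  rw [Finset.sum_range_succ', rho_pow_length] at h₁
  exact add_right_cancel h₁

theorem cyc_rho_pow (g : List (Homog 𝒱) → M) (j : ℕ) (l : List (Homog 𝒱)) :
    cyc ((rho 1)^[j] g) l = cyc g l := by
  induction j with
  | zero => rfl
  | succ j ih =>
    rw [rho_pow_succ_apply, ← ih, ← sum_rho_pow_succ ((rho 1)^[j] g)]
    exact Finset.sum_congr rfl fun i _ => by rw [rho_pow_succ_apply']

theorem rho_cyc (g : List (Homog 𝒱) → M) : rho 1 (cyc g) = cyc g := by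
  funext l
  cases l with
  | nil => rfl
  | cons x t =>
    rw [← sum_rho_pow_succ, rho_cons, cyc, Finset.smul_sum]
    refine Finset.sum_congr (by simp) fun i _ => ?_
    rw [rho_pow_succ_apply, rho_cons]

theorem cyc_apply_comm {g : List (Homog 𝒱) → List (Homog 𝒱) → M} (us ws : List (Homog 𝒱)) :
    cyc (fun us => cyc (g us)) us ws = cyc (cyc g us) ws := by
  have h₁ : ∀ us, cyc (fun us => cyc (g us)) us ws = cyc (fun us => cyc (g us) ws) us := fun us =>
    (cyc_map (Pi.evalAddMonoidHom (fun _ : List (Homog 𝒱) => M) ws) (fun us => cyc (g us)) us).symm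
  let φ : (List (Homog 𝒱) → M) →+ M :=
    { toFun := fun f => cyc f ws
      map_zero' := cyc_map (0 : M →+ M) 0 ws
      map_add' := fun f f' => cyc_add f f' ws }
  rw [h₁]
  exact cyc_map φ g us

/-! ### Insertions of an operation -/

section Insertion

variable (B : List (Homog 𝒱) → Homog 𝒱)

/-- The insertion of an operation with `m + 1` inputs after the first `r` inputs. -/
def insertion (m r : ℕ) (g : List (Homog 𝒱) → M) (l : List (Homog 𝒱)) : M :=
  sgn (parity 1 (l.take r)) • g (l.take r ++ B ((l.drop r).take (m + 1)) :: l.drop (r + m + 1))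

theorem insertion_append {m r : ℕ} (g : List (Homog 𝒱) → M) (u v w : List (Homog 𝒱))
    (hu : u.length = r) (hv : v.length = m + 1) :
    insertion B m r g (u ++ (v ++ w)) = sgn (parity 1 u) • g (u ++ B v :: w) := by
  subst hu
  rw [insertion, List.take_left, List.drop_left, ← hv, List.take_left, add_assoc, ← hv,
    ← List.drop_drop, List.drop_left, List.drop_left]

/-- The sum of all insertions at the beginning. -/
def prefixSum (g : List (Homog 𝒱) → M) (l : List (Homog 𝒱)) : M :=
  ∑ m ∈ Finset.range l.length, g (B (l.take (m + 1)) :: l.drop (m + 1))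

/-- The sum of all insertions. -/
def insertSum (g : List (Homog 𝒱) → M) (l : List (Homog 𝒱)) : M :=
  ∑ m ∈ Finset.range l.length, ∑ r ∈ Finset.range (l.length - m), insertion B m r g l

@[simp] theorem insertSum_nil (g : List (Homog 𝒱) → M) : insertSum B g [] = 0 := rfl

/-- Either the operation consumes `x`, or it passes `x` and, being odd, acquires the sign of `x`. -/
theorem insertSum_cons (g : List (Homog 𝒱) → M) (x : Homog 𝒱) (l : List (Homog 𝒱)) :
    insertSum B g (x :: l) = prefixSum B g (x :: l) +
      sgn (x.deg + 1) • insertSum B (fun l => g (x :: l)) l := by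
  have h₁ : ∀ m ∈ Finset.range (x :: l).length,
      ∑ r ∈ Finset.range ((x :: l).length - m), insertion B m r g (x :: l) =
      g (B ((x :: l).take (m + 1)) :: (x :: l).drop (m + 1)) +
      ∑ r ∈ Finset.range (l.length - m),
        sgn (x.deg + 1) • insertion B m r (fun l => g (x :: l)) l := by
    intro m hm
    rw [Finset.mem_range, List.length_cons] at hm
    rw [List.length_cons, show l.length + 1 - m = l.length - m + 1 by omega,
      Finset.sum_range_succ', add_comm]
    congr 1
    · simp [insertion, sgn_zero]
    · refine Finset.sum_congr rfl fun r _ => ?_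
      rw [insertion, insertion, smul_smul, ← sgn_add,
        show r + 1 + m + 1 = (r + m + 1) + 1 by omega]
      simp
  -- For `m = l.length` the operation takes the whole list, so the second sum has no term there.
  rw [insertSum, Finset.sum_congr rfl h₁, Finset.sum_add_distrib, List.length_cons,
    Finset.sum_range_succ (fun m => ∑ r ∈ Finset.range (l.length - m), _), Nat.sub_self,
    Finset.sum_range_zero, add_zero, insertSum, Finset.smul_sum, prefixSum, List.length_cons]
  simp only [Finset.smul_sum]

theorem prefixSum_append_cons (g : List (Homog 𝒱) → M) (us ws : List (Homog 𝒱)) (x : Homog 𝒱) :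
    prefixSum B g (us ++ x :: ws) = prefixSum B (fun u => g (u ++ x :: ws)) us +
      ∑ t ∈ Finset.range (ws.length + 1), g (B (us ++ x :: ws.take t) :: ws.drop t) := by
  rw [prefixSum, List.length_append, List.length_cons, Finset.sum_range_add]
  congr 1
  · refine Finset.sum_congr rfl fun m hm => ?_
    rw [Finset.mem_range] at hm
    rw [List.take_append_of_le_length (by omega), List.drop_append_of_le_length (by omega)]
    rfl
  · refine Finset.sum_congr rfl fun m hm => ?_
    rw [add_assoc, List.take_length_add_append, List.drop_length_add_append]
    rfl

/-- The insertions into `us ++ x :: ws`, according to the position of `x`. -/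
theorem insertSum_append_cons (g : List (Homog 𝒱) → M) (us ws : List (Homog 𝒱)) (x : Homog 𝒱) :
    insertSum B g (us ++ x :: ws) = insertSum B (fun u => g (u ++ x :: ws)) us +
      ∑ r ∈ Finset.range (us.length + 1), ∑ t ∈ Finset.range (ws.length + 1),
        sgn (parity 1 (us.take r)) •
          g (us.take r ++ B (us.drop r ++ x :: ws.take t) :: ws.drop t) +
      sgn (parity 1 us + (x.deg + 1)) • insertSum B (fun w => g (us ++ x :: w)) ws := by
  induction us generalizing g with
  | nil =>
    have := prefixSum_append_cons B g [] ws x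
    rw [List.nil_append] at this
    rw [List.nil_append, insertSum_cons, this]
    simp [prefixSum, sgn_zero]
  | cons y us ih =>
    rw [List.cons_append, insertSum_cons, ih, ← List.cons_append, prefixSum_append_cons,
      insertSum_cons, List.length_cons, Finset.sum_range_succ' _ (us.length + 1)]
    simp only [List.take_zero, List.drop_zero, parity_nil, sgn_zero, one_smul, List.nil_append,
      List.take_succ_cons, List.drop_succ_cons, parity_cons, sgn_add, smul_add, Finset.smul_sum,
      smul_smul, List.cons_append, mul_assoc]
    abel

variable {B}

/-- Both sides evaluate `g` on `t' ++ B v :: t`. Since `B` is odd, moving `B v` past `t'` costs the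
sign of moving `v` past `t'` times the sign of `B` passing `t'`. -/
theorem rho_pow_cons_eq (hB : ∀ l, ((B l).deg : ZMod 2) + 1 = parity 1 l + 1) {m : ℕ}
    (g : List (Homog 𝒱) → M) (v t t' : List (Homog 𝒱))
    (hv : v.length = m + 1) :
    (rho 1)^[t.length + 1] g (B v :: t ++ t') =
      (rho 1)^[m + 1 + t.length] (insertion B m t'.length g) (v ++ (t ++ t')) := by
  rw [rho_pow_append 1 g (B v :: t) t' (by simp), ← List.append_assoc,
    rho_pow_append 1 _ (v ++ t) t' (by simp [hv]), insertion_append B g t' v t rfl hv, smul_smul,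
    ← sgn_add]
  congr 2
  rw [parity_cons, hB, parity_append]
  ring

theorem cyc_cons_eq (hB : ∀ l, ((B l).deg : ZMod 2) + 1 = parity 1 l + 1) {m : ℕ}
    (g : List (Homog 𝒱) → M) (v t : List (Homog 𝒱))
    (hv : v.length = m + 1) :
    cyc g (B v :: t) = ∑ r ∈ Finset.range (t.length + 1),
      (rho 1)^[m + 1 + (t.length - r)] (insertion B m r g) (v ++ t) := by
  rw [← sum_rho_pow_succ, List.length_cons, ← Finset.sum_range_reflect]
  refine Finset.sum_congr rfl fun r hr => ?_
  rw [Finset.mem_range] at hr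
  have h₁ := rho_pow_cons_eq hB g v (t.take (t.length - r)) (t.drop (t.length - r)) hv
  rw [List.cons_append, List.take_append_drop, List.length_take, List.length_drop,
    min_eq_left (by omega), show t.length - (t.length - r) = r by omega] at h₁
  rw [← h₁, show t.length + 1 - 1 - r = t.length - r by omega]

/-- Cyclic sums of insertions at the beginning into a cyclic sum are cyclic sums of all
insertions. -/
theorem cyc_prefixSum_cyc (hB : ∀ l, ((B l).deg : ZMod 2) + 1 = parity 1 l + 1)
    (g : List (Homog 𝒱) → M) (l : List (Homog 𝒱)) :
    cyc (prefixSum B (cyc g)) l = cyc (insertSum B g) l := by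
  -- The index `r` counts the letters that the inner rotation places in front of the inserted
  -- operation. The outer `cyc` absorbs the remaining rotation by `cyc_rho_pow`.
  have h₁ : ∀ l' : List (Homog 𝒱), l'.length = l.length → prefixSum B (cyc g) l' =
      ∑ m ∈ Finset.range l.length, ∑ r ∈ Finset.range (l.length - m),
        (rho 1)^[l.length - r] (insertion B m r g) l' := by
    intro l' hl
    rw [prefixSum, hl]
    refine Finset.sum_congr rfl fun m hm => ?_
    rw [Finset.mem_range] at hm
    rw [cyc_cons_eq (m := m) hB _ _ _ (by simp; omega), List.take_append_drop, List.length_drop,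
      show l'.length - (m + 1) + 1 = l.length - m by omega]
    refine Finset.sum_congr rfl fun r hr => ?_
    rw [Finset.mem_range] at hr
    rw [show m + 1 + (l'.length - (m + 1) - r) = l.length - r by omega]
  have h₂ : ∀ l' : List (Homog 𝒱), l'.length = l.length → insertSum B g l' =
      ∑ m ∈ Finset.range l.length, ∑ r ∈ Finset.range (l.length - m), insertion B m r g l' := by
    intro l' hl
    simp only [insertSum, hl]
  rw [cyc_congr h₁ l rfl, cyc_congr h₂ l rfl]
  simp only [cyc_sum, cyc_rho_pow]

/-- Cyclic sums of insertions of an operation with one input into an invariant function. -/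
theorem cyc_insertion_zero (hB : ∀ l, ((B l).deg : ZMod 2) + 1 = parity 1 l + 1)
    {g : List (Homog 𝒱) → M} {n : ℕ}
    (hg : ∀ l, l.length = n → rho 1 g l = g l) (l : List (Homog 𝒱)) (hl : l.length = n) :
    cyc (insertion B 0 0 g) l = ∑ i ∈ Finset.range l.length, insertion B 0 i g l := by
  have hg' : ∀ (i : ℕ) (l : List (Homog 𝒱)), l.length = n → (rho 1)^[i] g l = g l := by
    intro i
    induction i with
    | zero => intro l _; rfl
    | succ i ih =>
      intro l hl
      rw [rho_pow_succ_apply', rho_pow_congr 1 hg i l hl, ih l hl]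
  refine Finset.sum_congr rfl fun i hi => ?_
  rw [Finset.mem_range] at hi
  obtain ⟨u, x, t, rfl, rfl⟩ : ∃ u x t, l = u ++ ([x] ++ t) ∧ u.length = i :=
    ⟨l.take i, l[i], l.drop (i + 1), by simp, by simp; omega⟩
  have h₁ := insertion_append B g [] [x] (t ++ u) (m := 0) rfl rfl
  rw [rho_pow_append 1 _ u _ rfl, insertion_append B g u [x] t (m := 0) rfl rfl,
    List.append_assoc]
  rw [List.nil_append, List.length_nil] at h₁
  -- Invariance of `g` turns the inserted list `u ++ B [x] :: t` into `B [x] :: (t ++ u)`, the form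
  -- produced by inserting at the front.
  rw [h₁, ← hg' u.length (u ++ B [x] :: t) (by rw [← hl]; simp), rho_pow_append 1 _ u _ rfl,
    smul_smul, smul_smul, ← sgn_add, List.nil_append, ← sgn_add, List.cons_append]
  congr 2
  rw [parity_cons 1 (B [x]), hB]
  simp only [parity_cons, parity_nil, List.nil_append, add_zero]
  have h2 : (2 : ZMod 2) = 0 := rfl
  linear_combination (-parity 1 u) * h2

end Insertion

end Graded

section Graded

variable {k V W : Type*} [Field k] [AddCommGroup V] [Module k V] [AddCommGroup W] [Module k W]
variable {𝒱 : ℤ → Submodule k V}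

/-! ### Total degrees, and cyclic permutations evaluated as rotations of lists. -/

theorem zmod_two_eq_zero : (2 : ZMod 2) = 0 := rfl

/-- The sum of the degrees of the entries of a list. -/
def degSum (l : List (Homog 𝒱)) : ℤ := (l.map Homog.deg).sum

@[simp] theorem degSum_nil : degSum ([] : List (Homog 𝒱)) = 0 := rfl

@[simp] theorem degSum_cons (x : Homog 𝒱) (l : List (Homog 𝒱)) :
    degSum (x :: l) = x.deg + degSum l := by simp [degSum]

@[simp] theorem degSum_append (l l' : List (Homog 𝒱)) :
    degSum (l ++ l') = degSum l + degSum l' := by simp [degSum]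

theorem cast_degSum (l : List (Homog 𝒱)) : ((degSum l : ℤ) : ZMod 2) = parity 0 l := by
  induction l with
  | nil => simp
  | cons x l ih => simp [ih]

theorem sum_entry_deg {n : ℕ} (l : List (Homog 𝒱)) (h : l.length = n) :
    ∑ i : Fin n, (entry l i.1).deg = degSum l := by
  subst h
  induction l with
  | nil => rfl
  | cons x l ih =>
    rw [List.length_cons, Fin.sum_univ_succ, degSum_cons, ← ih]
    rfl

/-- A multilinear map as a linear map in one of its arguments. -/
def evLinear {n : ℕ} (f : MultilinearMap k (fun _ : Fin n => V) W) (l l' : List (Homog 𝒱))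
    (h : l.length < n) : V →ₗ[k] W :=
  f.toLinearMap (fun i => (entry (l ++ default :: l') i.1).vec) ⟨l.length, h⟩

theorem evLinear_apply {n : ℕ} (f : MultilinearMap k (fun _ : Fin n => V) W)
    (l l' : List (Homog 𝒱)) (h : l.length < n) (x : Homog 𝒱) :
    evLinear f l l' h x.vec = ev f (l ++ x :: l') := by
  rw [evLinear, MultilinearMap.toLinearMap_apply, ev]
  congr 1
  funext i
  rcases eq_or_ne i ⟨l.length, h⟩ with rfl | hi
  · simp [entry_append_right]
  · rw [Function.update_of_ne hi]
    have hi' : i.1 ≠ l.length := fun e => hi (Fin.ext e)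
    rcases lt_or_ge i.1 l.length with h₁ | h₁
    · rw [entry_append_left _ _ h₁, entry_append_left _ _ h₁]
    · obtain ⟨j, hj⟩ : ∃ j, i.1 - l.length = j + 1 := ⟨i.1 - l.length - 1, by omega⟩
      rw [entry_append_right _ _ h₁, entry_append_right _ _ h₁, hj, entry_cons_succ,
        entry_cons_succ]

theorem zeta_zero_left (q : ℕ) : zeta 0 q = 1 := by
  rw [zeta, Subsingleton.elim (finRotate 0) 1]
  ext i
  simp [Equiv.Perm.sumCongr_one]

theorem xi_zero_right (p : ℕ) : xi p 0 = 1 := by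
  rw [xi, Subsingleton.elim (finRotate 0) 1]
  ext i
  simp [Equiv.Perm.sumCongr_one]

variable [DirectSum.Decomposition 𝒱]

/-- The passage from permutations of `Fin (p + q)` to rotations of lists. An empty block is allowed
because `Cyc` also constrains the components with `p = 0` or `q = 0`. -/
theorem ev_permute_zeta_eq_rho (c : ZMod 2) {p q : ℕ}
    (f : MultilinearMap k (fun _ : Fin (p + q) => V) W) (us ws : List (Homog 𝒱))
    (hu : us.length = p) (hw : ws.length = q) :
    ev (permute 𝒱 c (zeta p q) f) (us ++ ws) = rho c (fun us => ev f (us ++ ws)) us := by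
  cases us with
  | nil =>
    subst hu
    have := zeta_zero_left q
    change ev (permute 𝒱 c (zeta 0 q) f) _ = _
    rw [this, permute_one]
    rfl
  | cons x us => rw [ev_permute_zeta c f us ws x hu hw, rho_cons]

theorem ev_permute_xi_eq_rho (c : ZMod 2) {p q : ℕ}
    (f : MultilinearMap k (fun _ : Fin (p + q) => V) W) (us ws : List (Homog 𝒱))
    (hu : us.length = p) (hw : ws.length = q) :
    ev (permute 𝒱 c (xi p q) f) (us ++ ws) = rho c (fun ws => ev f (us ++ ws)) ws := by
  cases ws with
  | nil =>
    subst hw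
    have := xi_zero_right p
    change ev (permute 𝒱 c (xi p 0) f) _ = _
    rw [this, permute_one]
    rfl
  | cons x ws => rw [ev_permute_xi c f us ws x hu hw, rho_cons]

theorem ev_permute_zeta_pow (c : ZMod 2) {p q : ℕ} (i : ℕ)
    (f : MultilinearMap k (fun _ : Fin (p + q) => V) W) (us ws : List (Homog 𝒱))
    (hu : us.length = p) (hw : ws.length = q) :
    ev (permute 𝒱 c (zeta p q ^ i) f) (us ++ ws) =
      (rho c)^[i] (fun us => ev f (us ++ ws)) us := by
  induction i generalizing f with
  | zero => rw [pow_zero, permute_one]; rfl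
  | succ i ih =>
    rw [pow_succ, permute_mul, ih, rho_pow_succ_apply']
    exact rho_pow_congr c (fun us' hu' => ev_permute_zeta_eq_rho c f us' ws hu' hw) i us hu

theorem ev_permute_xi_pow (c : ZMod 2) {p q : ℕ} (i : ℕ)
    (f : MultilinearMap k (fun _ : Fin (p + q) => V) W) (us ws : List (Homog 𝒱))
    (hu : us.length = p) (hw : ws.length = q) :
    ev (permute 𝒱 c (xi p q ^ i) f) (us ++ ws) =
      (rho c)^[i] (fun ws => ev f (us ++ ws)) ws := by
  induction i generalizing f with
  | zero => rw [pow_zero, permute_one]; rfl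
  | succ i ih =>
    rw [pow_succ, permute_mul, ih, rho_pow_succ_apply']
    exact rho_pow_congr c (fun ws' hw' => ev_permute_xi_eq_rho c f us ws' hu hw') i ws hw

/-! ### Desuspension of permutations -/

/-- The extra factor is the signature of a cycle of length `p`, coming from the permuted odd arrows.
It exchanges cyclic skew-symmetry on `V` with cyclic invariance on `↓V`. -/
theorem desuspend_permute_zeta {p q : ℕ} (hp : 1 ≤ p)
    (f : MultilinearMap k (fun _ : Fin (p + q) => V) W) :
    desuspend 𝒱 (permute 𝒱 0 (zeta p q) f) =
      ((-1 : ℤ) ^ (p + 1)) • permute 𝒱 1 (zeta p q) (desuspend 𝒱 f) := by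
  refine form_ext_homog (𝒱 := 𝒱) fun us ws hu hw => ?_
  obtain ⟨x, t, rfl⟩ : ∃ x t, us = x :: t := by
    cases us with
    | nil => simp at hu; omega
    | cons x t => exact ⟨x, t, rfl⟩
  have hu' : t.length + 1 = p := hu
  rw [ev_desuspend _ _ (by simp; omega), ev_permute_zeta _ _ _ _ _ hu hw, ev_zsmul,
    ev_permute_zeta _ _ _ _ _ hu hw, ev_desuspend _ _ (by simp; omega), smul_smul, smul_smul,
    smul_smul, ← sgn_natCast, ← sgn_add, ← sgn_add, ← sgn_add]
  congr 2
  subst hu' hw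
  simp only [List.cons_append, arrowParity, arrowParity_append, parity_one, parity_append,
    parity_cons, parity_nil, List.length_append, List.length_cons, List.length_nil]
  push_cast
  linear_combination (-(t.length : ZMod 2) - 1 - parity 0 t) * zmod_two_eq_zero

theorem desuspend_permute_xi {p q : ℕ} (hq : 1 ≤ q)
    (f : MultilinearMap k (fun _ : Fin (p + q) => V) W) :
    desuspend 𝒱 (permute 𝒱 0 (xi p q) f) =
      ((-1 : ℤ) ^ (q + 1)) • permute 𝒱 1 (xi p q) (desuspend 𝒱 f) := by
  refine form_ext_homog (𝒱 := 𝒱) fun us ws hu hw => ?_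
  obtain ⟨x, t, rfl⟩ : ∃ x t, ws = x :: t := by
    cases ws with
    | nil => simp at hw; omega
    | cons x t => exact ⟨x, t, rfl⟩
  have hw' : t.length + 1 = q := hw
  rw [ev_desuspend _ _ (by simp; omega), ev_permute_xi _ _ _ _ _ hu hw, ev_zsmul,
    ev_permute_xi _ _ _ _ _ hu hw, ev_desuspend _ _ (by simp; omega), smul_smul, smul_smul,
    smul_smul, ← sgn_natCast, ← sgn_add, ← sgn_add, ← sgn_add]
  congr 2
  subst hu hw'
  simp only [arrowParity, arrowParity_append, parity_one, List.length_append, List.length_cons,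
    List.length_nil]
  push_cast
  linear_combination (-(t.length : ZMod 2) - 1 - parity 0 t) * zmod_two_eq_zero

theorem desuspend_permute_zeta_pow {p q : ℕ} (hp : 1 ≤ p) (i : ℕ)
    (f : MultilinearMap k (fun _ : Fin (p + q) => V) W) :
    desuspend 𝒱 (permute 𝒱 0 (zeta p q ^ i) f) =
      ((-1 : ℤ) ^ (i * (p + 1))) • permute 𝒱 1 (zeta p q ^ i) (desuspend 𝒱 f) := by
  induction i generalizing f with
  | zero => simp [permute_one]
  | succ i ih =>
    rw [pow_succ, permute_mul, ih, desuspend_permute_zeta hp, permute_mul, map_zsmul, smul_smul,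
      ← pow_add, add_mul, one_mul]

theorem desuspend_permute_xi_pow {p q : ℕ} (hq : 1 ≤ q) (i : ℕ)
    (f : MultilinearMap k (fun _ : Fin (p + q) => V) W) :
    desuspend 𝒱 (permute 𝒱 0 (xi p q ^ i) f) =
      ((-1 : ℤ) ^ (i * (q + 1))) • permute 𝒱 1 (xi p q ^ i) (desuspend 𝒱 f) := by
  induction i generalizing f with
  | zero => simp [permute_one]
  | succ i ih =>
    rw [pow_succ, permute_mul, ih, desuspend_permute_xi hq, permute_mul, map_zsmul, smul_smul,
      ← pow_add, add_mul, one_mul]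

/-! ### The operations on the desuspension -/

theorem AInfStructure.ev_mu_mem (Γ : AInfStructure 𝒱) {n : ℕ} (l : List (Homog 𝒱))
    (hl : l.length = n) : ev (Γ.μ n) l ∈ 𝒱 (degSum l + 2 - l.length) := by
  rcases Nat.eq_zero_or_pos n with rfl | hn
  · rw [Γ.μ_zero]
    exact Submodule.zero_mem _
  · have := Γ.degree n hn (fun i => (entry l i.1).deg) (fun i => (entry l i.1).vec)
      (fun i => (entry l i.1).mem)
    rw [sum_entry_deg l hl] at this
    rw [hl, add_sub_assoc]
    exact this

/-- The operations on the desuspension, applied to a list of homogeneous elements. -/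
def AInfStructure.op (Γ : AInfStructure 𝒱) (l : List (Homog 𝒱)) : Homog 𝒱 where
  deg := degSum l + 2 - l.length
  vec := ev (Γ.mc l.length) l
  mem := by
    rw [AInfStructure.mc, ev_desuspend _ _ rfl]
    exact Submodule.smul_of_tower_mem _ _ (Γ.ev_mu_mem l rfl)

theorem AInfStructure.op_vec (Γ : AInfStructure 𝒱) {n : ℕ} (l : List (Homog 𝒱))
    (hl : l.length = n) : (Γ.op l).vec = ev (Γ.mc n) l := by
  subst hl; rfl

/-- Oddness of the operations on `↓V`, in the form of the hypothesis `hB` of the insertion lemmas.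
-/
theorem AInfStructure.op_parity (Γ : AInfStructure 𝒱) (l : List (Homog 𝒱)) :
    ((Γ.op l).deg : ZMod 2) + 1 = parity 1 l + 1 := by
  simp only [AInfStructure.op]
  push_cast
  rw [cast_degSum, parity_one]
  linear_combination (1 - (l.length : ZMod 2)) * zmod_two_eq_zero

theorem AInfStructure.ev_insertAt_mc (Γ : AInfStructure 𝒱) {M N l r : ℕ} (h : M + 1 = N + l)
    (hr : r < N) (f : MultilinearMap k (fun _ : Fin N => V) W)
    (l₁ l₂ l₃ : List (Homog 𝒱)) (h₁ : l₁.length = r) (h₂ : l₂.length = l) :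
    ev (insertAt 𝒱 1 1 h r hr (Γ.mc l) f) (l₁ ++ (l₂ ++ l₃)) =
      sgn (parity 1 l₁) • ev f (l₁ ++ Γ.op l₂ :: l₃) := by
  rw [ev_insertAt 1 1 h hr _ f l₁ l₂ l₃ h₁ h₂ _ (Γ.op_vec l₂ h₂), one_mul]

/-- The factor is precisely the sign in the structure equation, so desuspending that equation leaves
only Koszul signs. -/
theorem AInfStructure.desuspend_insertAt (Γ : AInfStructure 𝒱) {M N l r : ℕ} (h : M + 1 = N + l)
    (hr : r < N) (f : MultilinearMap k (fun _ : Fin N => V) W) :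
    desuspend 𝒱 (insertAt 𝒱 0 (l : ZMod 2) h r hr (Γ.μ l) f) =
      ((-1 : ℤ) ^ (r + l * (M - r - l))) • insertAt 𝒱 1 1 h r hr (Γ.mc l) (desuspend 𝒱 f) := by
  refine multilinear_ext_homog (𝒱 := 𝒱) fun L hL => ?_
  obtain ⟨l₁, l₂, l₃, rfl, h₁, h₂, h₃⟩ : ∃ l₁ l₂ l₃, L = l₁ ++ (l₂ ++ l₃) ∧ l₁.length = r ∧
      l₂.length = l ∧ l₃.length = M - r - l :=
    ⟨L.take r, (L.drop r).take l, (L.drop r).drop l, by simp, by simp; omega, by simp; omega,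
      by simp [hL]; omega⟩
  have hN : (l₁ ++ Γ.op l₂ :: l₃).length = N := by simp; omega
  -- The outputs of `Γ.op` and `Γ.μ` on `l₂` differ by the desuspension sign, which comes out by
  -- linearity in that slot.
  have hy : ev f (l₁ ++ Γ.op l₂ :: l₃) =
      sgn (arrowParity l₂) • ev f (l₁ ++ ⟨_, _, Γ.ev_mu_mem l₂ h₂⟩ :: l₃) := by
    rw [← evLinear_apply f l₁ l₃ (by omega), ← evLinear_apply f l₁ l₃ (by omega),
      ← map_zsmul]
    congr 1
    rw [Γ.op_vec l₂ h₂, AInfStructure.mc, ev_desuspend _ _ h₂]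
  rw [ev_desuspend _ _ hL, ev_insertAt 0 _ h hr _ f l₁ l₂ l₃ h₁ h₂
      ⟨_, _, Γ.ev_mu_mem l₂ h₂⟩ rfl, ev_zsmul,
    Γ.ev_insertAt_mc h hr _ l₁ l₂ l₃ h₁ h₂, ev_desuspend _ _ hN, hy, smul_smul, smul_smul,
    smul_smul, smul_smul, ← sgn_natCast, ← sgn_add, ← sgn_add, ← sgn_add, ← sgn_add]
  congr 2
  rw [← h₃, ← h₁, ← h₂]
  have hop := Γ.op_parity l₂
  simp only [arrowParity_append, arrowParity, List.length_append, List.length_cons]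
  rw [parity_one] at hop ⊢
  push_cast
  linear_combination (-(l₃.length : ZMod 2)) * hop + (-(l₃.length : ZMod 2) * l₂.length +
    parity 0 l₁ * l₂.length - l₁.length - parity 0 l₁) * zmod_two_eq_zero

/-- The structure equation in terms of the operations on the desuspension. -/
theorem AInfStructure.insertSum_op (Γ : AInfStructure 𝒱) (l : List (Homog 𝒱)) :
    insertSum Γ.op (fun l => (Γ.op l).vec) l = 0 := by
  rcases Nat.eq_zero_or_pos l.length with h0 | hn
  · rw [List.length_eq_zero_iff] at h0
    subst h0
    rfl
  have h₁ := congrArg (fun f => ev (desuspend 𝒱 f) l) (Γ.relation l.length hn)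
  simp only [map_sum, map_zsmul, map_zero, ev_sum, ev_zero, ev_zsmul] at h₁
  rw [insertSum, Finset.sum_range, ← h₁]
  refine Finset.sum_congr rfl fun m _ => ?_
  rw [Finset.sum_range]
  refine Finset.sum_congr rfl fun r _ => ?_
  have hm := m.2
  have hr := r.2
  obtain ⟨l₁, l₂, l₃, hl, g₁, g₂⟩ : ∃ l₁ l₂ l₃, l = l₁ ++ (l₂ ++ l₃) ∧ l₁.length = r.1 ∧
      l₂.length = m.1 + 1 :=
    ⟨l.take r, (l.drop r).take (m + 1), (l.drop r).drop (m + 1), by simp, by simp; omega,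
      by simp; omega⟩
  rw [Γ.desuspend_insertAt, ev_zsmul, smul_smul, ← pow_add, Even.neg_one_pow ⟨_, rfl⟩, one_smul]
  have h₂ := insertion_append Γ.op (fun l => (Γ.op l).vec) l₁ l₂ l₃ g₁ g₂
  have h₃ := Γ.ev_insertAt_mc (M := l.length) (N := l.length - m.1) (by omega) r.2
    (Γ.mc (l.length - m.1)) l₁ l₂ l₃ g₁ g₂
  rw [← hl] at h₂ h₃
  rw [h₂]
  refine Eq.trans ?_ h₃.symm
  rw [Γ.op_vec (n := l.length - m.1)]
  have := congrArg List.length hl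
  simp at this ⊢
  omega

end Graded

section Graded

variable {k V : Type*} [Field k] [AddCommGroup V] [Module k V]
variable {𝒱 : ℤ → Submodule k V}
variable {M M' : Type*} [AddCommGroup M] [AddCommGroup M']

/-! ### Cyclic sums over both blocks -/

theorem rho_pow_add (c : ZMod 2) (i : ℕ) (g g' : List (Homog 𝒱) → M) :
    (rho c)^[i] (g + g') = (rho c)^[i] g + (rho c)^[i] g' := by
  funext l
  have h₁ := rho_pow_map c (AddMonoidHom.fst M M + AddMonoidHom.snd M M) (fun l => (g l, g' l)) i l
  rw [AddMonoidHom.add_apply, ← rho_pow_map, ← rho_pow_map] at h₁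
  exact h₁

/-- Iterated rotation as a homomorphism. -/
def rhoPowHom (c : ZMod 2) (i : ℕ) : (List (Homog 𝒱) → M) →+ (List (Homog 𝒱) → M) :=
  AddMonoidHom.mk' (rho c)^[i] (rho_pow_add c i)

/-- The cyclic sum as a homomorphism. -/
def cycHom : (List (Homog 𝒱) → M) →+ (List (Homog 𝒱) → M) :=
  AddMonoidHom.mk' cyc fun g g' => funext fun l => cyc_add g g' l

/-- The sum over the cyclic rotations of both blocks. -/
def dcyc (F : List (Homog 𝒱) → List (Homog 𝒱) → M) (us ws : List (Homog 𝒱)) : M :=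
  cyc (fun us => cyc (F us) ws) us

theorem dcyc_eq (F : List (Homog 𝒱) → List (Homog 𝒱) → M) (us ws : List (Homog 𝒱)) :
    dcyc F us ws = cyc (cyc F us) ws := by
  rw [← cyc_apply_comm]
  exact cyc_map (Pi.evalAddMonoidHom (fun _ : List (Homog 𝒱) => M) ws) (fun us => cyc (F us)) us

theorem dcyc_congr {F F' : List (Homog 𝒱) → List (Homog 𝒱) → M} (us ws : List (Homog 𝒱))
    (h : ∀ us' ws', us'.length = us.length → ws'.length = ws.length → F us' ws' = F' us' ws') :
    dcyc F us ws = dcyc F' us ws :=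
  cyc_congr (fun us' hu => cyc_congr (fun ws' hw => h us' ws' hu hw) ws rfl) us rfl

theorem dcyc_neg (F : List (Homog 𝒱) → List (Homog 𝒱) → M) (us ws : List (Homog 𝒱)) :
    dcyc (fun us ws => -F us ws) us ws = -dcyc F us ws := by
  simp only [dcyc, cyc_neg]

theorem dcyc_add (F F' : List (Homog 𝒱) → List (Homog 𝒱) → M) (us ws : List (Homog 𝒱)) :
    dcyc (fun us ws => F us ws + F' us ws) us ws = dcyc F us ws + dcyc F' us ws := by
  simp only [dcyc, cyc_add]

theorem dcyc_sum {ι : Type*} (s : Finset ι) (F : ι → List (Homog 𝒱) → List (Homog 𝒱) → M)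
    (us ws : List (Homog 𝒱)) :
    dcyc (fun us ws => ∑ j ∈ s, F j us ws) us ws = ∑ j ∈ s, dcyc (F j) us ws := by
  simp only [dcyc, cyc_sum]

theorem dcyc_rho_pow (F : List (Homog 𝒱) → List (Homog 𝒱) → M) (r t : ℕ)
    (us ws : List (Homog 𝒱)) :
    dcyc ((rho 1)^[r] fun us => (rho 1)^[t] (F us)) us ws = dcyc F us ws := by
  rw [dcyc_eq, dcyc_eq, cyc_rho_pow]
  have := cyc_map (rhoPowHom 1 t) F us
  exact (congrArg (fun g => cyc g ws) this).trans (cyc_rho_pow _ _ _)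

section Insertion

variable (B : List (Homog 𝒱) → Homog 𝒱)

theorem insertSum_map (φ : M →+ M') (g : List (Homog 𝒱) → M) (l : List (Homog 𝒱)) :
    insertSum B (fun l => φ (g l)) l = φ (insertSum B g l) := by
  simp [insertSum, insertion]

theorem insertSum_add (g g' : List (Homog 𝒱) → M) :
    insertSum B (g + g') = insertSum B g + insertSum B g' := by
  funext l
  have h₁ := insertSum_map B (AddMonoidHom.fst M M + AddMonoidHom.snd M M) (fun l => (g l, g' l)) l
  rw [AddMonoidHom.add_apply, ← insertSum_map, ← insertSum_map] at h₁
  exact h₁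

/-- The sum of all insertions as a homomorphism. -/
def insertSumHom : (List (Homog 𝒱) → M) →+ (List (Homog 𝒱) → M) :=
  AddMonoidHom.mk' (insertSum B) (insertSum_add B)

variable {B}

/-- Every insertion of an odd operation changes the total parity by one, so a sign depending on that
parity factors out shifted. -/
theorem insertSum_parity_smul (hB : ∀ l, ((B l).deg : ZMod 2) + 1 = parity 1 l + 1)
    (s : ZMod 2 → ℤ) (g : List (Homog 𝒱) → M) (l : List (Homog 𝒱)) :
    insertSum B (fun l => s (parity 1 l) • g l) l = s (parity 1 l + 1) • insertSum B g l := by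
  have h₁ : ∀ m r, parity 1 (l.take r ++ B ((l.drop r).take (m + 1)) :: l.drop (r + m + 1)) =
      parity 1 l + 1 := by
    intro m r
    rw [parity_append, parity_cons, hB, add_assoc r, ← List.drop_drop]
    have e₁ := congrArg (parity 1) (List.take_append_drop r l)
    have e₂ := congrArg (parity 1) (List.take_append_drop (m + 1) (l.drop r))
    rw [parity_append] at e₁ e₂
    rw [← e₁, ← e₂]
    ring
  simp only [insertSum, insertion, h₁, Finset.smul_sum]
  exact Finset.sum_congr rfl fun m _ => Finset.sum_congr rfl fun r _ => smul_comm _ _ _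

theorem cyc_prefixSum_dcyc_left (hB : ∀ l, ((B l).deg : ZMod 2) + 1 = parity 1 l + 1)
    (F : List (Homog 𝒱) → List (Homog 𝒱) → M) (us ws : List (Homog 𝒱)) :
    cyc (prefixSum B fun us => dcyc F us ws) us =
      dcyc (fun us ws => insertSum B (fun us => F us ws) us) us ws := by
  have h₁ : ∀ us, insertSum B (fun us => cyc (F us) ws) us =
      cyc (fun ws => insertSum B (fun us => F us ws) us) ws := by
    intro us
    have h₂ := insertSum_map B ((Pi.evalAddMonoidHom (fun _ : List (Homog 𝒱) => M) ws).comp cycHom)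
      F us
    refine h₂.trans ?_
    change cyc (insertSum B F us) ws = _
    congr 1
    funext w
    exact (insertSum_map B (Pi.evalAddMonoidHom (fun _ : List (Homog 𝒱) => M) w) F us).symm
  refine (cyc_prefixSum_cyc hB (fun us => cyc (F us) ws) us).trans ?_
  exact congrArg (fun g => cyc g us) (funext h₁)

theorem cyc_prefixSum_dcyc_right (hB : ∀ l, ((B l).deg : ZMod 2) + 1 = parity 1 l + 1)
    (F : List (Homog 𝒱) → List (Homog 𝒱) → M) (us ws : List (Homog 𝒱)) :
    cyc (prefixSum B (dcyc F us)) ws = dcyc (fun us => insertSum B (F us)) us ws := by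
  rw [dcyc_eq, show dcyc F us = cyc (cyc F us) from funext fun ws => dcyc_eq F us ws,
    cyc_prefixSum_cyc hB]
  exact congrArg (fun g => cyc g ws) (cyc_map (insertSumHom B) F us).symm

end Insertion

variable [DirectSum.Decomposition 𝒱]

/-! ### Traces of the operations -/

variable (𝒱) in
/-- Multiplication of `x` by `(-1) ^ ((|x| + 1) (1 + a))`. -/
def twist (a : ZMod 2) : V →ₗ[k] V := ∑ ε : ZMod 2, sgn ((ε + 1) * (1 + a)) • parityPart 𝒱 ε

theorem twist_apply (a : ZMod 2) (x : Homog 𝒱) :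
    twist 𝒱 a x.vec = sgn ((x.deg + 1) * (1 + a)) • x.vec := by
  simp [twist, parityPart_of_mem _ x.mem, LinearMap.sum_apply]

/-- A map that shifts degrees by a nonzero amount has no diagonal blocks. -/
theorem trace_eq_zero_of_shift [FiniteDimensional k V] (f : V →ₗ[k] V) (m : ℤ) (hm : m ≠ 0)
    (hf : ∀ x : Homog 𝒱, f x.vec ∈ 𝒱 (x.deg + m)) : LinearMap.trace k V f = 0 :=
  LinearMap.trace_eq_zero_of_mapsTo_ne (DirectSum.Decomposition.isInternal 𝒱) (fun d => d + m)
    (fun d h => hm (by simpa using h)) fun d v hv => hf ⟨d, v, hv⟩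

variable (Γ : AInfStructure 𝒱)

/-- The operation with one free input. -/
def AInfStructure.opLinear (us ws : List (Homog 𝒱)) : V →ₗ[k] V :=
  evLinear (Γ.mc (us.length + ws.length + 1)) us ws (by omega)

theorem AInfStructure.opLinear_apply (us ws : List (Homog 𝒱)) (x : Homog 𝒱) :
    Γ.opLinear us ws x.vec = (Γ.op (us ++ x :: ws)).vec := by
  rw [AInfStructure.opLinear, evLinear_apply, Γ.op_vec]
  simp; omega

theorem AInfStructure.opLinear_mem (us ws : List (Homog 𝒱)) (x : Homog 𝒱) :
    Γ.opLinear us ws x.vec ∈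
      𝒱 (x.deg + (degSum us + degSum ws + 1 - us.length - ws.length)) := by
  rw [Γ.opLinear_apply]
  convert! (Γ.op (us ++ x :: ws)).mem using 2
  simp [AInfStructure.op]
  ring

theorem AInfStructure.twist_comp_opLinear (a : ZMod 2) (us ws : List (Homog 𝒱)) :
    twist 𝒱 a ∘ₗ Γ.opLinear us ws =
      sgn ((parity 1 us + parity 1 ws + 1) * (1 + a)) • (Γ.opLinear us ws ∘ₗ twist 𝒱 a) := by
  refine linear_ext_homog (𝒱 := 𝒱) fun x => ?_
  rw [LinearMap.comp_apply, LinearMap.smul_apply, LinearMap.comp_apply, twist_apply, map_zsmul,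
    Γ.opLinear_apply, twist_apply, Γ.op_parity, smul_smul, ← sgn_add]
  congr 2
  simp
  ring

/-- The trace of an operation, in the sense of graded vector spaces, over one of its inputs. -/
def AInfStructure.loop (us ws : List (Homog 𝒱)) : k :=
  LinearMap.trace k V (Γ.opLinear us ws ∘ₗ twist 𝒱 (parity 1 ws))

theorem AInfStructure.loop_eq_zero [FiniteDimensional k V] (us ws : List (Homog 𝒱))
    (h : degSum us + degSum ws + 1 - us.length - ws.length ≠ 0) : Γ.loop us ws = 0 := by
  refine trace_eq_zero_of_shift (𝒱 := 𝒱) _ _ h fun x => ?_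
  rw [LinearMap.comp_apply, twist_apply, map_zsmul]
  exact Submodule.smul_of_tower_mem _ _ (Γ.opLinear_mem us ws x)

/-- The trace of a composition of two operations. -/
def AInfStructure.doubleLoop (u u' w w' : List (Homog 𝒱)) : k :=
  sgn (parity 1 u) • LinearMap.trace k V
    (Γ.opLinear u w' ∘ₗ Γ.opLinear u' w ∘ₗ twist 𝒱 (parity 1 w + parity 1 w'))

theorem AInfStructure.doubleLoop_eq_zero [FiniteDimensional k V] (u u' w w' : List (Homog 𝒱))
    (h : parity 1 u + parity 1 u' + parity 1 w + parity 1 w' ≠ 0) :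
    Γ.doubleLoop u u' w w' = 0 := by
  rw [AInfStructure.doubleLoop, trace_eq_zero_of_shift (𝒱 := 𝒱) _
    ((degSum u' + degSum w + 1 - u'.length - w.length) +
      (degSum u + degSum w' + 1 - u.length - w'.length)) ?_ fun x => ?_, smul_zero]
  · intro h0
    apply h
    have h₁ := congrArg (Int.cast : ℤ → ZMod 2) h0
    push_cast at h₁
    simp only [cast_degSum] at h₁
    simp only [parity_one]
    linear_combination h₁ + (-1 + (u'.length : ZMod 2) + u.length + w'.length + w.length) *
      zmod_two_eq_zero
  · rw [LinearMap.comp_apply, LinearMap.comp_apply, twist_apply, map_zsmul, map_zsmul]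
    refine Submodule.smul_of_tower_mem _ _ ?_
    rw [← add_assoc]
    exact Γ.opLinear_mem u w' ⟨_, _, Γ.opLinear_mem u' w x⟩

/-- Cyclicity of the trace of a composition of two operations. -/
theorem AInfStructure.doubleLoop_swap [FiniteDimensional k V] (u u' w w' : List (Homog 𝒱)) :
    Γ.doubleLoop u u' w w' =
      -(sgn (parity 1 u * parity 1 u' + parity 1 w * parity 1 w') • Γ.doubleLoop u' u w' w) := by
  -- The sign identity needs even total parity; when it is odd, both traces vanish for degree
  -- reasons.
  by_cases h : parity 1 u + parity 1 u' + parity 1 w + parity 1 w' = 0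
  · rw [AInfStructure.doubleLoop, AInfStructure.doubleLoop, LinearMap.trace_comp_comm',
      LinearMap.comp_assoc, Γ.twist_comp_opLinear, LinearMap.comp_smul, map_zsmul, smul_smul,
      smul_smul, ← neg_smul, add_comm (parity 1 w') (parity 1 w)]
    congr 1
    rw [← sgn_add, ← sgn_add, ← neg_one_mul, ← sgn_one, ← sgn_add]
    congr 1
    generalize parity 1 u = a at *
    generalize parity 1 u' = b at *
    generalize parity 1 w = c at *
    generalize parity 1 w' = d at *
    revert a b c d
    decide
  · rw [Γ.doubleLoop_eq_zero _ _ _ _ h, Γ.doubleLoop_eq_zero u' u w' w, smul_zero, neg_zero]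
    intro h'
    apply h
    rw [← h']
    ring

/-- The trace of the structure equation. -/
theorem AInfStructure.loop_relation (us ws : List (Homog 𝒱)) :
    insertSum Γ.op (fun us => Γ.loop us ws) us +
      ∑ r ∈ Finset.range (us.length + 1), ∑ t ∈ Finset.range (ws.length + 1),
        Γ.doubleLoop (us.take r) (us.drop r) (ws.take t) (ws.drop t) +
      sgn (parity 1 us) • insertSum Γ.op (Γ.loop us) ws = 0 := by
  -- The identity holds already between operators, by the structure equation on `us ++ x :: ws`, and
  -- the trace is applied at the end. The three summands are the terms of `insertSum_append_cons`.
  have h₁ : insertSum Γ.op (fun us => Γ.opLinear us ws ∘ₗ twist 𝒱 (parity 1 ws)) us +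
      ∑ r ∈ Finset.range (us.length + 1), ∑ t ∈ Finset.range (ws.length + 1),
        sgn (parity 1 (us.take r)) • (Γ.opLinear (us.take r) (ws.drop t) ∘ₗ
          Γ.opLinear (us.drop r) (ws.take t) ∘ₗ
            twist 𝒱 (parity 1 (ws.take t) + parity 1 (ws.drop t))) +
      sgn (parity 1 us) •
        insertSum Γ.op (fun ws => Γ.opLinear us ws ∘ₗ twist 𝒱 (parity 1 ws)) ws = 0 := by
    refine linear_ext_homog (𝒱 := 𝒱) fun x => ?_
    let φ : (V →ₗ[k] V) →+ V := (LinearMap.applyₗ (R := k) x.vec).toAddMonoidHom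
    have hφ : ∀ f : V →ₗ[k] V, f x.vec = φ f := fun _ => rfl
    have h₂ : ∀ (u w : List (Homog 𝒱)) (a : ZMod 2), φ (Γ.opLinear u w ∘ₗ twist 𝒱 a) =
        sgn ((x.deg + 1) * (1 + a)) • (Γ.op (u ++ x :: w)).vec := by
      intro u w a
      change Γ.opLinear u w (twist 𝒱 a x.vec) = _
      rw [twist_apply, map_zsmul, Γ.opLinear_apply]
    have h₃ : ∀ (u u' w w' : List (Homog 𝒱)) (a : ZMod 2),
        φ (Γ.opLinear u w' ∘ₗ Γ.opLinear u' w ∘ₗ twist 𝒱 a) =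
        sgn ((x.deg + 1) * (1 + a)) • (Γ.op (u ++ Γ.op (u' ++ x :: w) :: w')).vec := by
      intro u u' w w' a
      change Γ.opLinear u w' (Γ.opLinear u' w (twist 𝒱 a x.vec)) = _
      rw [twist_apply, map_zsmul, map_zsmul, Γ.opLinear_apply, Γ.opLinear_apply]
    have h₄ : ∀ t, parity 1 (ws.take t) + parity 1 (ws.drop t) = parity 1 ws := by
      intro t
      rw [← parity_append, List.take_append_drop]
    rw [hφ, hφ, map_zero, map_add, map_add, ← insertSum_map, map_zsmul, ← insertSum_map]
    simp only [map_sum, map_zsmul, h₂, h₃, h₄]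
    -- Insertion into `ws` changes the parity seen by `twist`; the resulting sign of `x` is the one
    -- acquired by the operation in passing `x`.
    rw [insertSum_parity_smul Γ.op_parity (fun a => sgn ((x.deg + 1) * (1 + a)))
      (fun w => (Γ.op (us ++ x :: w)).vec) ws]
    have h₅ := insertSum_map Γ.op
      (DistribSMul.toAddMonoidHom V (sgn (((x.deg : ZMod 2) + 1) * (1 + parity 1 ws))))
      (fun u => (Γ.op (u ++ x :: ws)).vec) us
    simp only [DistribSMul.toAddMonoidHom_apply] at h₅
    rw [h₅]
    have h₆ := congrArg (fun v => sgn (((x.deg : ZMod 2) + 1) * (1 + parity 1 ws)) • v)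
      (Γ.insertSum_op (us ++ x :: ws))
    rw [insertSum_append_cons, smul_zero] at h₆
    rw [← h₆, smul_add, smul_add, smul_smul, smul_smul, ← sgn_add, ← sgn_add]
    congr 1
    · congr 1
      simp only [Finset.smul_sum]
      exact Finset.sum_congr rfl fun r _ => Finset.sum_congr rfl fun t _ => smul_comm _ _ _
    · congr 2
      ring
  have h₂ := congrArg (LinearMap.trace k V).toAddMonoidHom h₁
  rw [map_zero, map_add, map_add, ← insertSum_map, map_zsmul, ← insertSum_map] at h₂
  simp only [map_sum, map_zsmul] at h₂
  exact h₂

/-- The cuts `(r, t)` and `(us.length - r, ws.length - t)` give the same two factors in opposite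
order, up to a rotation of both blocks that `dcyc` does not see. By `doubleLoop_swap` they
contribute opposite values. -/
theorem AInfStructure.dcyc_doubleLoop [FiniteDimensional k V] [CharZero k]
    (us ws : List (Homog 𝒱)) :
    dcyc (fun us ws => ∑ r ∈ Finset.range (us.length + 1), ∑ t ∈ Finset.range (ws.length + 1),
      Γ.doubleLoop (us.take r) (us.drop r) (ws.take t) (ws.drop t)) us ws = 0 := by
  let Y : ℕ → ℕ → List (Homog 𝒱) → List (Homog 𝒱) → k := fun r t us ws =>
    Γ.doubleLoop (us.take r) (us.drop r) (ws.take t) (ws.drop t)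
  have h₁ : ∀ r t, r ≤ us.length → t ≤ ws.length →
      dcyc (Y r t) us ws = -dcyc (Y (us.length - r) (ws.length - t)) us ws := by
    intro r t hr ht
    rw [← dcyc_rho_pow (Y (us.length - r) (ws.length - t)) r t, ← dcyc_neg]
    refine dcyc_congr us ws fun us' ws' hu hw => ?_
    obtain ⟨u, u', rfl, rfl⟩ : ∃ u u', us' = u ++ u' ∧ u.length = r :=
      ⟨us'.take r, us'.drop r, by simp, by simp; omega⟩
    obtain ⟨w, w', rfl, rfl⟩ : ∃ w w', ws' = w ++ w' ∧ w.length = t :=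
      ⟨ws'.take t, ws'.drop t, by simp, by simp; omega⟩
    rw [List.length_append] at hu hw
    have e₁ : us.length - u.length = u'.length := by omega
    have e₂ : ws.length - w.length = w'.length := by omega
    rw [rho_pow_append 1 _ u u' rfl, Pi.smul_apply, rho_pow_append 1 _ w w' rfl, e₁, e₂]
    simp only [Y, List.take_left, List.drop_left]
    rw [Γ.doubleLoop_swap, sgn_add, mul_smul]
  have h₂ : dcyc (fun us ws => ∑ r ∈ Finset.range (us.length + 1),
      ∑ t ∈ Finset.range (ws.length + 1),
        Γ.doubleLoop (us.take r) (us.drop r) (ws.take t) (ws.drop t)) us ws =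
      ∑ r ∈ Finset.range (us.length + 1), ∑ t ∈ Finset.range (ws.length + 1),
        dcyc (Y r t) us ws := by
    simp only [← dcyc_sum]
    exact dcyc_congr us ws fun us' ws' hu hw => by rw [hu, hw]
  rw [h₂]
  -- A cut may be paired with itself, so the cancellation is obtained from `a = -a`, using
  -- characteristic zero.
  refine self_eq_neg.1 ?_
  nth_rw 1 [← Finset.sum_range_reflect]
  rw [← Finset.sum_neg_distrib]
  refine Finset.sum_congr rfl fun r hr => ?_
  rw [← Finset.sum_range_reflect, ← Finset.sum_neg_distrib]
  refine Finset.sum_congr rfl fun t ht => ?_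
  rw [Finset.mem_range] at hr ht
  rw [h₁ _ _ (by omega) (by omega), show us.length - (us.length + 1 - 1 - r) = r by omega,
    show ws.length - (ws.length + 1 - 1 - t) = t by omega]

/-- The cyclic sums of the traces of the operations form a cocycle. -/
theorem AInfStructure.dcyc_loop_closed [FiniteDimensional k V] [CharZero k]
    (us ws : List (Homog 𝒱)) :
    cyc (prefixSum Γ.op fun us => dcyc Γ.loop us ws) us +
      sgn (parity 1 us) • cyc (prefixSum Γ.op (dcyc Γ.loop us)) ws = 0 := by
  have h₁ : sgn (parity 1 us) • dcyc (fun us => insertSum Γ.op (Γ.loop us)) us ws =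
      dcyc (fun us ws => sgn (parity 1 us) • insertSum Γ.op (Γ.loop us) ws) us ws := by
    have h₂ : ∀ us : List (Homog 𝒱),
        cyc (fun ws => sgn (parity 1 us) • insertSum Γ.op (Γ.loop us) ws) ws =
        sgn (parity 1 us) • cyc (insertSum Γ.op (Γ.loop us)) ws := fun us =>
      cyc_smul (fun _ => sgn (parity 1 us)) (fun _ _ => rfl) _ ws
    simp only [dcyc, h₂]
    refine (cyc_smul (fun us => sgn (parity 1 us)) (fun x t => ?_) _ us).symm
    simp [add_comm]
  rw [cyc_prefixSum_dcyc_left Γ.op_parity, cyc_prefixSum_dcyc_right Γ.op_parity, h₁, ← dcyc_add,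
    ← add_zero (dcyc _ us ws)]
  -- The vanishing sum of double loops is added back, so that the summand becomes the left side of
  -- `loop_relation`.
  nth_rw 1 [← Γ.dcyc_doubleLoop us ws]
  rw [← dcyc_add]
  have h₃ : ∀ us ws : List (Homog 𝒱), insertSum Γ.op (fun us => Γ.loop us ws) us +
      sgn (parity 1 us) • insertSum Γ.op (Γ.loop us) ws +
      ∑ r ∈ Finset.range (us.length + 1), ∑ t ∈ Finset.range (ws.length + 1),
        Γ.doubleLoop (us.take r) (us.drop r) (ws.take t) (ws.drop t) = 0 := by
    intro us ws
    rw [← Γ.loop_relation us ws]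
    abel
  simp only [h₃]
  have h₄ : ∀ l : List (Homog 𝒱), cyc (fun _ => (0 : k)) l = 0 := fun l =>
    cyc_map (0 : k →+ k) (fun _ => 0) l
  simp only [dcyc, h₄]

end Graded

section Graded

variable {k V : Type*} [Field k] [AddCommGroup V] [Module k V]
variable {𝒱 : ℤ → Submodule k V}

/-! ### Families of forms as functions of two lists. -/

theorem neg_one_pow_congr {m n : ℕ} (h : (m : ZMod 2) = n) : (-1 : ℤ) ^ m = (-1) ^ n := by
  rw [← sgn_natCast, ← sgn_natCast, h]

/-- A family of forms as a function of two lists of homogeneous elements. -/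
def evPair (x : FormFamily k V) (us ws : List (Homog 𝒱)) : k :=
  ev (x us.length ws.length) (us ++ ws)

theorem evPair_eq (x : FormFamily k V) {p q : ℕ} (us ws : List (Homog 𝒱)) (hu : us.length = p)
    (hw : ws.length = q) : evPair x us ws = ev (x p q) (us ++ ws) := by
  subst hu hw; rfl

theorem sum_entry_suffix {n : ℕ} (us ws : List (Homog 𝒱)) (x : Homog 𝒱)
    (h : (us ++ x :: ws).length = n) :
    (∑ i : Fin n, if us.length < i.1 then ((entry (us ++ x :: ws) i.1).deg : ZMod 2) else 0) =
      parity 0 ws := by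
  have h₁ := sum_entry_eq_parity (n := n) 0 (us ++ [x]) ws (by simp at h ⊢; omega)
  have h₂ := sum_entry_eq_parity (n := n) 0 (us ++ x :: ws) [] h.le
  simp only [List.append_assoc, List.append_nil, List.cons_append, List.nil_append,
    add_zero, h, Fin.is_lt, if_true] at h₁ h₂
  rw [show us ++ x :: ws = (us ++ [x]) ++ ws by simp, parity_append, ← h₁, List.append_assoc,
    List.cons_append, List.nil_append] at h₂
  have h₃ : (∑ i : Fin n, ((entry (us ++ x :: ws) i.1).deg : ZMod 2)) =
      (∑ i : Fin n, if i.1 < (us ++ [x]).length then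
        ((entry (us ++ x :: ws) i.1).deg : ZMod 2) else 0) +
      ∑ i : Fin n, if us.length < i.1 then ((entry (us ++ x :: ws) i.1).deg : ZMod 2) else 0 := by
    rw [← Finset.sum_add_distrib]
    refine Finset.sum_congr rfl fun i _ => ?_
    rw [List.length_append, List.length_singleton]
    split_ifs <;> first | omega | simp
  rw [h₃] at h₂
  exact add_left_cancel h₂

/-- Used with `P` fixing the length and the total degree, to show that cyclic sums of homogeneous
functions are homogeneous. -/
theorem cyc_eq_zero {M : Type*} [AddCommGroup M] {P : List (Homog 𝒱) → Prop}
    (hP : ∀ x t, P (x :: t) → P (t ++ [x])) {g : List (Homog 𝒱) → M} (hg : ∀ l, P l → g l = 0)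
    (l : List (Homog 𝒱)) (hl : P l) : cyc g l = 0 := by
  suffices h : ∀ i, (rho 1)^[i] g l = 0 from Finset.sum_eq_zero fun i _ => h i
  intro i
  induction i generalizing l with
  | zero => exact hg l hl
  | succ i ih =>
    rw [rho_pow_succ_apply]
    cases l with
    | nil => exact ih [] hl
    | cons x t => rw [rho_cons, ih _ (hP x t hl), smul_zero]

theorem dcyc_nil_right {M : Type*} [AddCommGroup M]
    (F : List (Homog 𝒱) → List (Homog 𝒱) → M) (us : List (Homog 𝒱)) : dcyc F us [] = 0 := by
  rw [dcyc_eq, cyc_nil]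

theorem isHomogeneousForm_iff {c : ℤ} {n : ℕ} {f : MultilinearMap k (fun _ : Fin n => V) k}
    {m : ℤ} : IsHomogeneousForm 𝒱 c f m ↔
      ∀ l : List (Homog 𝒱), l.length = n → degSum l - n * c + m ≠ 0 → ev f l = 0 := by
  constructor
  · intro h l hl hm
    refine h (fun i => (entry l i.1).deg) _ (fun i => (entry l i.1).mem) ?_
    rw [Finset.sum_sub_distrib, sum_entry_deg l hl]
    simpa using hm
  · intro h d v hv hm
    let l : List (Homog 𝒱) := List.ofFn fun i => ⟨d i, v i, hv i⟩
    have hl : l.length = n := by simp [l]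
    have h₁ := h l hl ?_
    · simpa [ev, l] using h₁
    · rw [← sum_entry_deg l hl]
      rw [Finset.sum_sub_distrib] at hm
      simpa [l] using hm

variable [DirectSum.Decomposition 𝒱] (Γ : AInfStructure 𝒱)

/-! ### The wheeled class -/

/-- Comparing the traces on `V` and on `↓V` gives a sign that depends on the degrees of the inputs.
It reduces to `(-1) ^ p` because the trace vanishes unless the operator has degree zero. -/
theorem AInfStructure.ev_desuspend_gradedTrace [FiniteDimensional k V] {p q : ℕ}
    (us ws : List (Homog 𝒱)) (hu : us.length = p) (hw : ws.length = q) :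
    ev (desuspend 𝒱 (gradedTrace 𝒱 (⟨p, by omega⟩ : Fin (p + q + 1)) (Γ.μ (p + q + 1))))
      (us ++ ws) = ((-1 : ℤ) ^ p) • Γ.loop us ws := by
  subst hu hw
  rw [ev_desuspend _ _ (by simp)]
  let P : Fin (us.length + ws.length + 1) := ⟨us.length, by omega⟩
  let G : V →ₗ[k] V := (signTwist 𝒱 (fun ε => sgn (ε P *
    (1 + ∑ j : Fin (us.length + ws.length + 1), if P < j then ε j else 0)))
      (Γ.μ (us.length + ws.length + 1))).toLinearMap
        (P.insertNth (0 : V) fun i => (entry (us ++ ws) i.1).vec) P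
  change sgn (arrowParity (us ++ ws)) • LinearMap.trace k V G = _
  have hG : Γ.opLinear us ws ∘ₗ twist 𝒱 (parity 1 ws) =
      sgn (arrowParity (us ++ ws) + (parity 0 us + parity 0 ws + ws.length + 1)) • G := by
    refine linear_ext_homog (𝒱 := 𝒱) fun x => ?_
    have hx : Function.update (P.insertNth (0 : V) fun i => (entry (us ++ ws) i.1).vec) P x.vec =
        fun i => (entry (us ++ x :: ws) i.1).vec := by
      rw [Fin.update_insertNth]
      funext i
      refine Fin.succAboveCases P ?_ (fun j => ?_) i
      · rw [Fin.insertNth_apply_same, entry_append_right _ _ le_rfl]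
        simp
      · rw [Fin.insertNth_apply_succAbove]
        rcases lt_or_ge j.1 us.length with hj | hj
        · rw [Fin.succAbove_of_castSucc_lt _ _ (by simpa [P, Fin.lt_def] using hj),
            Fin.val_castSucc, entry_append_left _ _ hj, entry_append_left _ _ hj]
        · rw [Fin.succAbove_of_le_castSucc _ _ (by simpa [P, Fin.le_def] using hj),
            Fin.val_succ, entry_append_right _ _ hj, entry_append_right _ _ (by omega),
            Nat.sub_add_comm hj, entry_cons_succ]
    have hlen : (us ++ x :: ws).length = us.length + ws.length + 1 := by simp; omega
    have h₁ : G x.vec = sgn (x.deg * (1 + parity 0 ws)) •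
        ev (Γ.μ (us.length + ws.length + 1)) (us ++ x :: ws) := by
      change (signTwist 𝒱 _ _) (Function.update _ P x.vec) = _
      rw [hx]
      refine (ev_signTwist _ _ (us ++ x :: ws)).trans ?_
      congr 3
      · simp [P, entry_append_right]
      · congr 1
        exact sum_entry_suffix us ws x hlen
    rw [LinearMap.comp_apply, twist_apply, map_zsmul, Γ.opLinear_apply, Γ.op_vec _ hlen,
      AInfStructure.mc, ev_desuspend _ _ hlen, LinearMap.smul_apply, h₁, smul_smul, smul_smul,
      ← sgn_add, ← sgn_add]
    congr 2
    simp only [arrowParity_append, arrowParity, parity_one, List.length_cons]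
    push_cast
    linear_combination ((x.deg : ZMod 2) * ws.length) * zmod_two_eq_zero
  have hT : Γ.loop us ws =
      sgn (arrowParity (us ++ ws) + (parity 0 us + parity 0 ws + ws.length + 1)) •
        LinearMap.trace k V G := by
    rw [AInfStructure.loop, hG, map_zsmul]
  -- This is the parity of the degree of the operator. If it is even, `h0` simplifies the sign; if
  -- it is odd, both traces are zero.
  by_cases h0 : parity 0 us + parity 0 ws + us.length + ws.length + 1 = 0
  · rw [hT, smul_smul, ← sgn_natCast, ← sgn_add]
    congr 2
    linear_combination -h0
  · have hz : Γ.loop us ws = 0 := by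
      refine Γ.loop_eq_zero us ws fun h => h0 ?_
      have h₁ := congrArg (Int.cast : ℤ → ZMod 2) h
      push_cast at h₁
      simp only [cast_degSum] at h₁
      linear_combination h₁ + ((us.length : ZMod 2) + ws.length) * zmod_two_eq_zero
    have hz' : LinearMap.trace k V G = 0 := by
      have := congrArg (fun a =>
        sgn (arrowParity (us ++ ws) + (parity 0 us + parity 0 ws + ws.length + 1)) • a) hT
      simpa only [smul_smul, sgn_mul_self, one_smul, hz, smul_zero] using this.symm
    rw [hz, hz', smul_zero, smul_zero]

theorem AInfStructure.ev_wheel [FiniteDimensional k V] {p q : ℕ} (us ws : List (Homog 𝒱))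
    (hu : us.length = p) (hw : ws.length = q) :
    ev (Γ.wheel p q) (us ++ ws) = dcyc Γ.loop us ws := by
  simp only [AInfStructure.wheel, AInfStructure.cycTrace, map_sum, map_zsmul, ev_zsmul, ev_sum,
    Finset.smul_sum, dcyc, cyc, hu, hw]
  rw [Finset.sum_range]
  refine Finset.sum_congr rfl fun i _ => ?_
  have h₁ : (rho 1)^[i.1] (fun us => ∑ j ∈ Finset.range q, (rho 1)^[j] (Γ.loop us) ws) us =
      ∑ j ∈ Finset.range q, (rho 1)^[i.1] (fun us => (rho 1)^[j] (Γ.loop us) ws) us := by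
    have h₂ := rho_pow_map 1
      (∑ j ∈ Finset.range q, Pi.evalAddMonoidHom (fun _ : ℕ => k) j)
      (fun us j => (rho 1)^[j] (Γ.loop us) ws) i.1 us
    simp only [AddMonoidHom.finsetSum_apply, Pi.evalAddMonoidHom_apply] at h₂
    rw [h₂]
    exact Finset.sum_congr rfl fun j _ => (rho_pow_map 1
      (Pi.evalAddMonoidHom (fun _ : ℕ => k) j) (fun us j => (rho 1)^[j] (Γ.loop us) ws) i.1 us).symm
  rw [h₁, Finset.sum_range]
  refine Finset.sum_congr rfl fun j _ => ?_
  have hi := i.2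
  have hj := j.2
  rw [permute_mul, desuspend_permute_zeta_pow (by omega), desuspend_permute_xi_pow (by omega),
    map_zsmul, ev_zsmul, ev_zsmul, ev_permute_zeta_pow 1 i.1 _ us ws hu hw, smul_smul, smul_smul,
    smul_smul]
  have h₂ : ∀ us', us'.length = p →
      ev (permute 𝒱 1 (xi p q ^ j.1) (desuspend 𝒱
        (gradedTrace 𝒱 (⟨p, by omega⟩ : Fin (p + q + 1)) (Γ.μ (p + q + 1))))) (us' ++ ws) =
      ((-1 : ℤ) ^ p) • (rho 1)^[j.1] (Γ.loop us') ws := by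
    intro us' hu'
    rw [ev_permute_xi_pow 1 j.1 _ us' ws hu' hw, ← rho_pow_smul 1 (fun _ => (-1 : ℤ) ^ p)
      (fun _ _ => rfl)]
    exact rho_pow_congr 1 (fun ws' hw' => Γ.ev_desuspend_gradedTrace us' ws' hu' hw') _ ws hw
  rw [rho_pow_congr 1 h₂ i.1 us hu, rho_pow_smul 1 (fun _ => (-1 : ℤ) ^ p) (fun _ _ => rfl),
    smul_smul]
  -- Each sign occurs twice: the skew signs of `cycTrace` meet those of the desuspended rotations,
  -- and the `(-1) ^ p` of `wheel` meets that of the trace.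
  rw [← pow_add, ← pow_add, ← pow_add, ← pow_add,
    Even.neg_one_pow ⟨p + i.1 * (p + 1) + j.1 * (q + 1), by ring⟩, one_smul]

theorem AInfStructure.evPair_wheel [FiniteDimensional k V] (us ws : List (Homog 𝒱)) :
    evPair Γ.wheel us ws = dcyc Γ.loop us ws := Γ.ev_wheel us ws rfl rfl

end Graded

section Graded

variable {k V : Type*} [Field k] [AddCommGroup V] [Module k V]
variable {𝒱 : ℤ → Submodule k V}
theorem cyc_const_smul (s : ℤ) (g : List (Homog 𝒱) → k) (l : List (Homog 𝒱)) :
    cyc (fun l => s • g l) l = s • cyc g l :=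
  cyc_smul (fun _ => s) (fun _ _ => rfl) g l

theorem cyc_prefixSum (B : List (Homog 𝒱) → Homog 𝒱) (g : List (Homog 𝒱) → k)
    (l : List (Homog 𝒱)) :
    cyc (prefixSum B g) l = ∑ a : Fin l.length, cyc (insertion B a.1 0 g) l := by
  rw [← cyc_sum]
  refine cyc_congr (fun l' hl => ?_) l rfl
  rw [prefixSum, hl, Finset.sum_range]
  refine Finset.sum_congr rfl fun a _ => ?_
  simp [insertion, sgn_zero]

variable [DirectSum.Decomposition 𝒱] (Γ : AInfStructure 𝒱)

/-! ### The differential -/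

theorem neg_one_pow_smul_eq_iff {A : Type*} [AddCommGroup A] (n : ℕ) {a b : A} :
    ((-1 : ℤ) ^ n) • a = b ↔ a = ((-1 : ℤ) ^ n) • b := by
  rcases neg_one_pow_eq_or ℤ n with h | h <;> simp [h, neg_eq_iff_eq_neg]

theorem AInfStructure.ev_insertAt_left {p q a N : ℕ} (ha : a < p)
    (hN : p + q + 1 = N + q + (a + 1)) (h : 0 < N + q) (x : FormFamily k V)
    (us ws : List (Homog 𝒱)) (hu : us.length = p) (hw : ws.length = q) :
    ev (insertAt 𝒱 1 1 hN 0 h (Γ.mc (a + 1)) (x N q)) (us ++ ws) =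
      insertion Γ.op a 0 (fun us => evPair x us ws) us := by
  have h₁ := Γ.ev_insertAt_mc hN h (x N q) [] (us.take (a + 1)) (us.drop (a + 1) ++ ws) rfl
    (by simp; omega)
  have h₂ := insertion_append Γ.op (fun us => evPair x us ws) [] (us.take (a + 1))
    (us.drop (a + 1)) (m := a) rfl (by simp; omega)
  rw [List.nil_append, ← List.append_assoc, List.take_append_drop] at h₁
  rw [List.nil_append, List.take_append_drop] at h₂
  refine (h₁.trans ?_).trans h₂.symm
  rw [evPair_eq x (p := N) (q := q) _ ws (by simp; omega) hw]
  rfl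

theorem AInfStructure.ev_insertAt_right {p q a N : ℕ} (ha : a < q)
    (hN : p + q + 1 = p + N + (a + 1)) (h : p < p + N) (x : FormFamily k V)
    (us ws : List (Homog 𝒱)) (hu : us.length = p) (hw : ws.length = q) :
    ev (insertAt 𝒱 1 1 hN p h (Γ.mc (a + 1)) (x p N)) (us ++ ws) =
      sgn (parity 1 us) • insertion Γ.op a 0 (evPair x us) ws := by
  have h₁ := Γ.ev_insertAt_mc hN h (x p N) us (ws.take (a + 1)) (ws.drop (a + 1)) hu
    (by simp; omega)
  have h₂ := insertion_append Γ.op (evPair x us) [] (ws.take (a + 1))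
    (ws.drop (a + 1)) (m := a) rfl (by simp; omega)
  rw [List.take_append_drop] at h₁
  rw [List.nil_append, List.take_append_drop, List.nil_append, parity_nil, sgn_zero, one_smul]
    at h₂
  refine h₁.trans ?_
  rw [List.length_nil] at h₂
  rw [h₂, evPair_eq x (p := p) (q := N) us _ hu (by simp; omega)]

theorem sum_ev_permute_zeta {p q : ℕ} (f : MultilinearMap k (fun _ : Fin (p + q) => V) k)
    {g : List (Homog 𝒱) → k} (us ws : List (Homog 𝒱)) (hu : us.length = p) (hw : ws.length = q)
    (hf : ∀ us' : List (Homog 𝒱), us'.length = p → ev f (us' ++ ws) = g us') :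
    ∑ i : Fin p, ev (permute 𝒱 1 (zeta p q ^ i.1) f) (us ++ ws) = cyc g us := by
  rw [cyc, Finset.sum_range, ← Fin.sum_congr' _ hu]
  refine Finset.sum_congr rfl fun i _ => ?_
  rw [ev_permute_zeta_pow 1 _ f us ws hu hw]
  exact rho_pow_congr 1 hf _ us hu

theorem sum_ev_permute_xi {p q : ℕ} (f : MultilinearMap k (fun _ : Fin (p + q) => V) k)
    {g : List (Homog 𝒱) → k} (us ws : List (Homog 𝒱)) (hu : us.length = p) (hw : ws.length = q)
    (hf : ∀ ws' : List (Homog 𝒱), ws'.length = q → ev f (us ++ ws') = g ws') :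
    ∑ i : Fin q, ev (permute 𝒱 1 (xi p q ^ i.1) f) (us ++ ws) = cyc g ws := by
  rw [cyc, Finset.sum_range, ← Fin.sum_congr' _ hw]
  refine Finset.sum_congr rfl fun i _ => ?_
  rw [ev_permute_xi_pow 1 _ f us ws hu hw]
  exact rho_pow_congr 1 hf _ ws hw

/-- The sign of `us` on the second summand comes from the odd operation passing the whole first
block. -/
theorem AInfStructure.ev_delta (n : ℤ) (x : FormFamily k V) {p q : ℕ} (us ws : List (Homog 𝒱))
    (hu : us.length = p) (hw : ws.length = q) :
    ev (Γ.delta n x p q) (us ++ ws) = (-(n.negOnePow : ℤ)) •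
      (cyc (prefixSum Γ.op fun us => evPair x us ws) us +
        sgn (parity 1 us) • cyc (prefixSum Γ.op (evPair x us)) ws) := by
  simp only [AInfStructure.delta, LinearMap.pi_apply, LinearMap.smul_apply, LinearMap.add_apply,
    LinearMap.sum_apply, LinearMap.comp_apply, LinearMap.proj_apply, ev_zsmul, ev_add, ev_sum]
  congr 2
  · subst hu
    rw [cyc_prefixSum]
    refine Finset.sum_congr rfl fun a _ => ?_
    exact sum_ev_permute_zeta _ us ws rfl hw fun us' hu' =>
      Γ.ev_insertAt_left a.2 _ _ x us' ws hu' hw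
  · subst hw
    rw [cyc_prefixSum, Finset.smul_sum]
    refine Finset.sum_congr rfl fun a _ => ?_
    rw [← cyc_const_smul]
    exact sum_ev_permute_xi _ us ws hu rfl fun ws' hw' =>
      Γ.ev_insertAt_right a.2 _ _ x us ws' hu hw'

theorem AInfStructure.delta_eq_zero_of_zero (n : ℤ) {p q : ℕ} (h : p = 0 ∨ q = 0)
    (x : FormFamily k V) (hx : ∀ p q, p = 0 ∨ q = 0 → x p q = 0) : Γ.delta n x p q = 0 := by
  refine form_ext_homog (𝒱 := 𝒱) fun us ws hu hw => ?_
  rw [Γ.ev_delta n x us ws hu hw, ev_zero]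
  have h₁ : ∀ us ws : List (Homog 𝒱), us.length = 0 ∨ ws.length = 0 → evPair x us ws = 0 := by
    intro us ws h
    rw [evPair, hx _ _ h, ev_zero]
  have h₀ : ∀ l : List (Homog 𝒱), cyc (fun _ => (0 : k)) l = 0 := fun l =>
    cyc_map (0 : k →+ k) (fun _ => 0) l
  rcases h with rfl | rfl
  · rw [List.length_eq_zero_iff] at hu
    subst hu
    have : prefixSum Γ.op (evPair x []) = fun _ => 0 := by
      funext l
      simp [prefixSum, h₁ [] _ (Or.inl rfl)]
    rw [this, h₀]
    simp
  · rw [List.length_eq_zero_iff] at hw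
    subst hw
    have : (prefixSum Γ.op fun us => evPair x us []) = fun _ => 0 := by
      funext l
      simp [prefixSum, h₁ _ [] (Or.inr rfl)]
    rw [this, h₀]
    simp

theorem AInfStructure.wheel_mem_cyc [FiniteDimensional k V] : Γ.wheel ∈ Cyc 𝒱 1 := by
  intro p q
  refine ⟨fun h => ?_, ?_, ?_, ?_⟩
  · refine form_ext_homog (𝒱 := 𝒱) fun us ws hu hw => ?_
    rw [Γ.ev_wheel us ws hu hw, ev_zero]
    rcases h with rfl | rfl
    · rw [List.length_eq_zero_iff.1 hu]
      rfl
    · rw [List.length_eq_zero_iff.1 hw, dcyc_nil_right]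
  · rw [isHomogeneousForm_iff]
    intro l hl hm
    have hu : (l.take p).length = p := by simp [hl]
    have hw : (l.drop p).length = q := by simp [hl]
    rw [← List.take_append_drop p l] at hm ⊢
    rw [Γ.ev_wheel _ _ hu hw]
    rw [degSum_append] at hm
    generalize l.take p = us at *
    generalize l.drop p = ws at *
    refine cyc_eq_zero (P := fun us' => us'.length = us.length ∧ degSum us' = degSum us)
      (fun x t => ?_) (fun us' hu' => ?_) us ⟨rfl, rfl⟩
    · simp [add_comm]
    · refine cyc_eq_zero (P := fun ws' => ws'.length = ws.length ∧ degSum ws' = degSum ws)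
        (fun x t => ?_) (fun ws' hw' => ?_) ws ⟨rfl, rfl⟩
      · simp [add_comm]
      · refine Γ.loop_eq_zero us' ws' fun h => hm ?_
        rw [← h, hu'.1, hu'.2, hw'.1, hw'.2, hu, hw]
        push_cast
        ring
  · refine form_ext_homog (𝒱 := 𝒱) fun us ws hu hw => ?_
    rw [ev_permute_zeta_eq_rho 1 _ us ws hu hw, Γ.ev_wheel us ws hu hw]
    have h₁ := rho_pow_congr 1 (g := fun us => ev (Γ.wheel p q) (us ++ ws))
      (g' := fun us => dcyc Γ.loop us ws) (fun us' hu' => Γ.ev_wheel us' ws hu' hw) 1 us hu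
    exact h₁.trans (congrFun (rho_cyc _) us)
  · refine form_ext_homog (𝒱 := 𝒱) fun us ws hu hw => ?_
    rw [ev_permute_xi_eq_rho 1 _ us ws hu hw, Γ.ev_wheel us ws hu hw, dcyc_eq]
    have h₁ := rho_pow_congr 1 (g := fun ws => ev (Γ.wheel p q) (us ++ ws))
      (g' := cyc (cyc Γ.loop us))
      (fun ws' hw' => (Γ.ev_wheel us ws' hu hw').trans (dcyc_eq _ _ _)) 1 ws hw
    exact h₁.trans (congrFun (rho_cyc _) ws)

theorem AInfStructure.wheel_mem_cocycles [FiniteDimensional k V] [CharZero k] :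
    Γ.wheel ∈ Γ.cocycles 1 := by
  refine ⟨Γ.wheel_mem_cyc, ?_⟩
  rw [SetLike.mem_coe, LinearMap.mem_ker]
  funext p q
  refine form_ext_homog (𝒱 := 𝒱) fun us ws hu hw => ?_
  have h₁ : ∀ us : List (Homog 𝒱), evPair Γ.wheel us = dcyc Γ.loop us := fun us =>
    funext fun ws => Γ.evPair_wheel us ws
  rw [Γ.ev_delta _ _ us ws hu hw]
  simp only [h₁]
  rw [Γ.dcyc_loop_closed us ws, smul_zero]
  rfl

/-! ### Wheeled extensions -/

/-- The forms on the desuspension that correspond to forms on the original space. -/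
def suspendForms (𝒱 : ℤ → Submodule k V) [DirectSum.Decomposition 𝒱] (θ : FormFamily k V) :
    FormFamily k V :=
  fun p q => ((-1 : ℤ) ^ (p + 1)) • desuspend 𝒱 (θ p q)

theorem desuspend_eq_suspendForms (θ : FormFamily k V) (p q : ℕ) :
    desuspend 𝒱 (θ p q) = ((-1 : ℤ) ^ (p + 1)) • suspendForms 𝒱 θ p q := by
  rw [suspendForms, smul_smul, ← pow_add, Even.neg_one_pow ⟨_, rfl⟩, one_smul]

theorem suspendForms_suspendForms (θ : FormFamily k V) :
    suspendForms 𝒱 (suspendForms 𝒱 θ) = θ := by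
  funext p q
  rw [suspendForms, suspendForms, map_zsmul, desuspend_desuspend, smul_smul, ← pow_add,
    Even.neg_one_pow ⟨_, rfl⟩, one_smul]

theorem suspendForms_homogeneous (θ : FormFamily k V) (p q : ℕ) :
    IsHomogeneousForm 𝒱 1 (suspendForms 𝒱 θ p q) 0 ↔
      IsHomogeneousForm 𝒱 0 (θ p q) (-((p : ℤ) + q)) := by
  rw [isHomogeneousForm_iff, isHomogeneousForm_iff]
  refine forall_congr' fun l => forall_congr' fun hl => ?_
  have h₁ : degSum l - ((p + q : ℕ) : ℤ) * 1 + 0 =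
      degSum l - ((p + q : ℕ) : ℤ) * 0 + -((p : ℤ) + q) := by
    push_cast
    ring
  rw [h₁, suspendForms, ev_zsmul, ev_desuspend _ _ hl, smul_smul]
  refine imp_congr Iff.rfl ⟨fun h => ?_, fun h => by rw [h, smul_zero]⟩
  have h₂ := congrArg (fun a => ((-1 : ℤ) ^ (p + 1) * sgn (arrowParity l)) • a) h
  rw [← sgn_natCast] at h₂
  simpa only [smul_smul, smul_zero, mul_mul_mul_comm _ (sgn (arrowParity l)), sgn_mul_self,
    one_mul, one_smul] using h₂

/-- The factor `(-1) ^ (p + 1)` in `suspendForms` is the sign of `desuspend_permute_zeta`, so the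
two absorb each other; for `xi` the sign involves `q` and has to be carried across. -/
theorem permute_zeta_suspendForms {p q : ℕ} (hp : 1 ≤ p) (θ : FormFamily k V) :
    permute 𝒱 1 (zeta p q) (suspendForms 𝒱 θ p q) = suspendForms 𝒱 θ p q ↔
      permute 𝒱 0 (zeta p q) (θ p q) = ((-1 : ℤ) ^ (p + 1)) • θ p q := by
  have h₁ := desuspend_permute_zeta (𝒱 := 𝒱) (q := q) hp (θ p q)
  rw [← map_zsmul] at h₁
  have h₂ : permute 𝒱 1 (zeta p q) (suspendForms 𝒱 θ p q) =
      desuspend 𝒱 (permute 𝒱 0 (zeta p q) (θ p q)) := h₁.symm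
  rw [h₂, suspendForms, ← map_zsmul]
  exact (Function.LeftInverse.injective desuspend_desuspend).eq_iff

theorem permute_xi_suspendForms {p q : ℕ} (hq : 1 ≤ q) (θ : FormFamily k V) :
    permute 𝒱 1 (xi p q) (suspendForms 𝒱 θ p q) = suspendForms 𝒱 θ p q ↔
      permute 𝒱 0 (xi p q) (θ p q) = ((-1 : ℤ) ^ (q + 1)) • θ p q := by
  have h₁ := desuspend_permute_xi (𝒱 := 𝒱) (p := p) hq (θ p q)
  have h₂ : ((-1 : ℤ) ^ (q + 1)) • desuspend 𝒱 (permute 𝒱 0 (xi p q) (θ p q)) =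
      permute 𝒱 1 (xi p q) (desuspend 𝒱 (θ p q)) := by
    rw [h₁, smul_smul, ← pow_add, Even.neg_one_pow ⟨_, rfl⟩, one_smul]
  rw [suspendForms, map_zsmul, neg_one_pow_smul_eq_iff, smul_smul, ← pow_add,
    Even.neg_one_pow ⟨_, rfl⟩, one_smul, ← h₂, neg_one_pow_smul_eq_iff, ← map_zsmul]
  exact (Function.LeftInverse.injective desuspend_desuspend).eq_iff

/-- The differential of the forms of a wheeled structure in the endomorphism complex. -/
def AInfStructure.formDifferential (θ : FormFamily k V) (p q : ℕ) :
    MultilinearMap k (fun _ : Fin (p + q) => V) k :=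
  -((-1 : ℤ) ^ (p + q)) • ∑ i : Fin (p + q),
    insertAt 𝒱 0 1 (M := p + q) (N := p + q) (l := 1) rfl i.1 i.2 (Γ.μ 1) (θ p q)

/-- The insertions of operations into the first block. -/
def AInfStructure.leftInsertions (θ : FormFamily k V) (p q : ℕ) :
    MultilinearMap k (fun _ : Fin (p + q) => V) k :=
  ∑ i : Fin p, ((-1 : ℤ) ^ (i.1 * (p + 1))) • permute 𝒱 0 (zeta p q ^ i.1)
    (∑ a : Fin (p - 1), ((-1 : ℤ) ^ ((a.1 + 2) * (p + q))) •
      insertAt 𝒱 0 ((a.1 + 2 : ℕ) : ZMod 2) (M := p + q) (N := p - 1 - a.1 + q) (l := a.1 + 2)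
        (by omega) 0 (by omega) (Γ.μ (a.1 + 2)) (θ (p - 1 - a.1) q))

/-- The insertions of operations into the second block. -/
def AInfStructure.rightInsertions (θ : FormFamily k V) (p q : ℕ) :
    MultilinearMap k (fun _ : Fin (p + q) => V) k :=
  ∑ j : Fin q, ((-1 : ℤ) ^ (j.1 * (q + 1))) • permute 𝒱 0 (xi p q ^ j.1)
    (∑ a : Fin (q - 1), ((-1 : ℤ) ^ (p + (a.1 + 2) + q * (a.1 + 2) + 1)) •
      insertAt 𝒱 0 ((a.1 + 2 : ℕ) : ZMod 2) (M := p + q) (N := p + (q - 1 - a.1)) (l := a.1 + 2)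
        (by omega) p (by omega) (Γ.μ (a.1 + 2)) (θ p (q - 1 - a.1)))

/-! ### The terms of the extension equation on `↓V`. -/

theorem AInfStructure.ev_formDifferential (θ : FormFamily k V) {p q : ℕ}
    (hζ : permute 𝒱 1 (zeta p q) (suspendForms 𝒱 θ p q) = suspendForms 𝒱 θ p q)
    (hξ : permute 𝒱 1 (xi p q) (suspendForms 𝒱 θ p q) = suspendForms 𝒱 θ p q)
    (us ws : List (Homog 𝒱)) (hu : us.length = p) (hw : ws.length = q) :
    ev (((-1 : ℤ) ^ p) • desuspend 𝒱 (Γ.formDifferential θ p q)) (us ++ ws) =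
      -(cyc (insertion Γ.op 0 0 fun us => evPair (suspendForms 𝒱 θ) us ws) us +
        sgn (parity 1 us) • cyc (insertion Γ.op 0 0 (evPair (suspendForms 𝒱 θ) us)) ws) := by
  have hins : ∀ i : Fin (p + q), desuspend 𝒱 (insertAt 𝒱 0 1 (M := p + q) (N := p + q) (l := 1)
      rfl i.1 i.2 (Γ.μ 1) (θ p q)) = ((-1 : ℤ) ^ (p + q + p)) •
        insertAt 𝒱 1 1 (M := p + q) (N := p + q) (l := 1) rfl i.1 i.2 (Γ.mc 1)
          (suspendForms 𝒱 θ p q) := by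
    intro i
    have hi := i.2
    have h₁ := Γ.desuspend_insertAt (l := 1) rfl i.2 (θ p q)
    rw [Nat.cast_one] at h₁
    rw [h₁, desuspend_eq_suspendForms, map_zsmul, smul_smul, ← pow_add]
    -- The sign does not depend on the position `i`, so it leaves the sum and cancels the
    -- prefactors.
    rw [show i.1 + 1 * (p + q - i.1 - 1) + (p + 1) = p + q + p by omega]
  have h₁ : ev (((-1 : ℤ) ^ p) • desuspend 𝒱 (Γ.formDifferential θ p q)) (us ++ ws) =
      -∑ i : Fin (p + q), ev (insertAt 𝒱 1 1 (M := p + q) (N := p + q) (l := 1) rfl i.1 i.2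
        (Γ.mc 1) (suspendForms 𝒱 θ p q)) (us ++ ws) := by
    rw [AInfStructure.formDifferential, map_zsmul, map_sum, Finset.sum_congr rfl fun i _ => hins i,
      ← Finset.smul_sum, smul_smul, smul_smul, ev_zsmul, ev_sum, mul_neg, neg_mul, ← pow_add,
      ← pow_add, neg_smul, Even.neg_one_pow ⟨p + q + p, by ring⟩, one_smul]
  rw [h₁, Fin.sum_univ_add]
  congr 2
  -- Cyclic invariance of the suspended forms is used here: inserting at every position of the block
  -- equals the cyclic sum of insertions at the front.
  · rw [cyc_insertion_zero Γ.op_parity (n := p) ?_ us hu, Finset.sum_range, ← Fin.sum_congr' _ hu]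
    · refine Finset.sum_congr rfl fun i _ => ?_
      have hi := i.2
      have h₂ := Γ.ev_insertAt_mc (M := p + q) (N := p + q) rfl
        (show i.1 < p + q by omega) (suspendForms 𝒱 θ p q)
        (us.take i) ((us.drop i).take 1) (us.drop (i + 1) ++ ws) (by simp) (by simp; omega)
      rw [← List.append_assoc _ _ ws, ← List.drop_drop, List.take_append_drop, ← List.append_assoc,
        List.take_append_drop] at h₂
      refine h₂.trans ?_
      rw [insertion, evPair_eq _ (p := p) (q := q) _ ws (by simp; omega) hw, List.append_assoc,
        List.cons_append, List.drop_drop]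
    · intro us' hu'
      have h₂ := ev_permute_zeta_eq_rho 1 (suspendForms 𝒱 θ p q) us' ws hu' hw
      rw [hζ, ← evPair_eq _ us' ws hu' hw] at h₂
      rw [h₂]
      exact rho_pow_congr 1 (fun us'' hu'' => evPair_eq _ us'' ws hu'' hw) 1 us' hu'
  · rw [cyc_insertion_zero Γ.op_parity (n := q) ?_ ws hw, Finset.sum_range, ← Fin.sum_congr' _ hw,
      Finset.smul_sum]
    · refine Finset.sum_congr rfl fun i _ => ?_
      have hi := i.2
      have h₂ := Γ.ev_insertAt_mc (M := p + q) (N := p + q) rfl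
        (show p + i.1 < p + q by omega) (suspendForms 𝒱 θ p q)
        (us ++ ws.take i) ((ws.drop i).take 1) (ws.drop (i + 1)) (by simp; omega) (by simp; omega)
      rw [← List.drop_drop, List.take_append_drop, List.append_assoc, List.take_append_drop] at h₂
      refine h₂.trans ?_
      rw [insertion, evPair_eq _ (p := p) (q := q) us _ hu (by simp; omega), List.append_assoc,
        List.drop_drop, parity_append, sgn_add, mul_smul]
    · intro ws' hw'
      have h₂ := ev_permute_xi_eq_rho 1 (suspendForms 𝒱 θ p q) us ws' hu hw'
      rw [hξ, ← evPair_eq _ us ws' hu hw'] at h₂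
      rw [h₂]
      exact rho_pow_congr 1 (fun ws'' hw'' => evPair_eq _ us ws'' hu hw'') 1 ws' hw'

theorem AInfStructure.ev_leftInsertions (θ : FormFamily k V) {p q : ℕ} (hp : 1 ≤ p)
    (us ws : List (Homog 𝒱)) (hu : us.length = p) (hw : ws.length = q) :
    ev (((-1 : ℤ) ^ p) • desuspend 𝒱 (Γ.leftInsertions θ p q)) (us ++ ws) =
      ∑ a : Fin (p - 1),
        cyc (insertion Γ.op (a.1 + 1) 0 fun us => evPair (suspendForms 𝒱 θ) us ws) us := by
  rw [ev_zsmul, AInfStructure.leftInsertions, map_sum, ev_sum, Finset.smul_sum, ← cyc_sum]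
  rw [← sum_ev_permute_zeta (((-1 : ℤ) ^ p) • ∑ a : Fin (p - 1),
      ((-1 : ℤ) ^ ((a.1 + 2) * (p + q))) • desuspend 𝒱
      (insertAt 𝒱 0 ((a.1 + 2 : ℕ) : ZMod 2) (M := p + q) (N := p - 1 - a.1 + q) (l := a.1 + 2)
        (by omega) 0 (by omega) (Γ.μ (a.1 + 2)) (θ (p - 1 - a.1) q))) us ws hu hw]
  · refine Finset.sum_congr rfl fun i _ => ?_
    rw [map_zsmul, desuspend_permute_zeta_pow hp, smul_smul, ← pow_add,
      Even.neg_one_pow ⟨_, rfl⟩, one_smul, map_zsmul, ev_zsmul]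
    simp only [map_sum, map_zsmul]
  · intro us' hu'
    rw [ev_zsmul, ev_sum, Finset.smul_sum]
    refine Finset.sum_congr rfl fun a _ => ?_
    have ha := a.2
    -- `b` counts the letters of the block left untouched; it removes truncated subtraction before
    -- the exponents are reduced modulo two.
    obtain ⟨b, hb⟩ : ∃ b, p = a.1 + 2 + b := ⟨p - (a.1 + 2), by omega⟩
    rw [Γ.desuspend_insertAt, desuspend_eq_suspendForms, map_zsmul, smul_smul, smul_smul, ev_zsmul,
      smul_smul, Γ.ev_insertAt_left (by omega) _ _ _ us' ws hu' hw, ← pow_add, ← pow_add,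
      ← pow_add, neg_one_pow_congr (n := 0), pow_zero, one_smul]
    rw [show p - 1 - a.1 = b + 1 by omega, show p + q - 0 - (a.1 + 2) = b + q by omega]
    have hb' := congrArg (Nat.cast : ℕ → ZMod 2) hb
    push_cast at hb' ⊢
    generalize (a.1 : ZMod 2) = a' at *
    generalize (b : ZMod 2) = b' at *
    generalize (q : ZMod 2) = q' at *
    generalize (p : ZMod 2) = p' at *
    clear * - hb'
    revert a' b' q' p'
    decide

theorem AInfStructure.ev_rightInsertions (θ : FormFamily k V) {p q : ℕ} (hq : 1 ≤ q)
    (us ws : List (Homog 𝒱)) (hu : us.length = p) (hw : ws.length = q) :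
    ev (((-1 : ℤ) ^ p) • desuspend 𝒱 (Γ.rightInsertions θ p q)) (us ++ ws) =
      sgn (parity 1 us) • ∑ a : Fin (q - 1),
        cyc (insertion Γ.op (a.1 + 1) 0 (evPair (suspendForms 𝒱 θ) us)) ws := by
  rw [ev_zsmul, AInfStructure.rightInsertions, map_sum, ev_sum, Finset.smul_sum, ← cyc_sum,
    ← cyc_const_smul]
  rw [← sum_ev_permute_xi (((-1 : ℤ) ^ p) • ∑ a : Fin (q - 1),
      ((-1 : ℤ) ^ (p + (a.1 + 2) + q * (a.1 + 2) + 1)) • desuspend 𝒱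
      (insertAt 𝒱 0 ((a.1 + 2 : ℕ) : ZMod 2) (M := p + q) (N := p + (q - 1 - a.1)) (l := a.1 + 2)
        (by omega) p (by omega) (Γ.μ (a.1 + 2)) (θ p (q - 1 - a.1)))) us ws hu hw]
  · refine Finset.sum_congr rfl fun i _ => ?_
    rw [map_zsmul, desuspend_permute_xi_pow hq, smul_smul, ← pow_add,
      Even.neg_one_pow ⟨_, rfl⟩, one_smul, map_zsmul, ev_zsmul]
    simp only [map_sum, map_zsmul]
  · intro ws' hw'
    rw [ev_zsmul, ev_sum, Finset.smul_sum, Finset.smul_sum]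
    refine Finset.sum_congr rfl fun a _ => ?_
    have ha := a.2
    obtain ⟨b, hb⟩ : ∃ b, q = a.1 + 2 + b := ⟨q - (a.1 + 2), by omega⟩
    rw [Γ.desuspend_insertAt, desuspend_eq_suspendForms, map_zsmul, smul_smul, smul_smul, ev_zsmul,
      smul_smul, Γ.ev_insertAt_right (by omega) _ _ _ us ws' hu hw', ← pow_add, ← pow_add,
      ← pow_add, neg_one_pow_congr (n := 0), pow_zero, one_smul]
    rw [show p + q - p - (a.1 + 2) = b by omega]
    have hb' := congrArg (Nat.cast : ℕ → ZMod 2) hb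
    push_cast at hb' ⊢
    generalize (a.1 : ZMod 2) = a' at *
    generalize (b : ZMod 2) = b' at *
    generalize (q : ZMod 2) = q' at *
    generalize (p : ZMod 2) = p' at *
    clear * - hb'
    revert a' b' q' p'
    decide

/-- In degree zero the differential carries an overall minus sign. With the factor `(-1) ^ (p + 1)`
in `suspendForms`, the result has the same prefactor `(-1) ^ p` as `wheel`. -/
theorem AInfStructure.delta_suspendForms (θ : FormFamily k V) {p q : ℕ} (hp : 1 ≤ p) (hq : 1 ≤ q)
    (hζ : permute 𝒱 1 (zeta p q) (suspendForms 𝒱 θ p q) = suspendForms 𝒱 θ p q)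
    (hξ : permute 𝒱 1 (xi p q) (suspendForms 𝒱 θ p q) = suspendForms 𝒱 θ p q) :
    Γ.delta 0 (suspendForms 𝒱 θ) p q = ((-1 : ℤ) ^ p) • desuspend 𝒱
      (Γ.formDifferential θ p q - (Γ.leftInsertions θ p q + Γ.rightInsertions θ p q)) := by
  refine form_ext_homog (𝒱 := 𝒱) fun us ws hu hw => ?_
  have h₁ : ∀ f g h : MultilinearMap k (fun _ : Fin (p + q) => V) k,
      ((-1 : ℤ) ^ p) • desuspend 𝒱 (f - (g + h)) = ((-1 : ℤ) ^ p) • desuspend 𝒱 f +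
        -(((-1 : ℤ) ^ p) • desuspend 𝒱 g + ((-1 : ℤ) ^ p) • desuspend 𝒱 h) := by
    intro f g h
    rw [map_sub, map_add, smul_sub, smul_add, sub_eq_add_neg]
  rw [Γ.ev_delta _ _ us ws hu hw, h₁, ev_add, ev_neg, ev_add,
    Γ.ev_formDifferential θ hζ hξ us ws hu hw,
    Γ.ev_leftInsertions θ hp us ws hu hw, Γ.ev_rightInsertions θ hq us ws hu hw,
    cyc_prefixSum, cyc_prefixSum]
  -- Successors allow the arity-one term `a = 0` to be split off from each sum over arities.
  obtain ⟨p, rfl⟩ := Nat.exists_eq_succ_of_ne_zero (Nat.one_le_iff_ne_zero.1 hp)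
  obtain ⟨q, rfl⟩ := Nat.exists_eq_succ_of_ne_zero (Nat.one_le_iff_ne_zero.1 hq)
  rw [← Fin.sum_congr' _ hu.symm, ← Fin.sum_congr' _ hw.symm, Fin.sum_univ_succ,
    Fin.sum_univ_succ]
  simp
  abel

theorem AInfStructure.differential_iff [FiniteDimensional k V] (θ : FormFamily k V) {p q : ℕ}
    (hp : 1 ≤ p) (hq : 1 ≤ q)
    (hζ : permute 𝒱 1 (zeta p q) (suspendForms 𝒱 θ p q) = suspendForms 𝒱 θ p q)
    (hξ : permute 𝒱 1 (xi p q) (suspendForms 𝒱 θ p q) = suspendForms 𝒱 θ p q) :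
    Γ.delta 0 (suspendForms 𝒱 θ) p q = Γ.wheel p q ↔
      Γ.formDifferential θ p q =
        Γ.cycTrace p q + Γ.leftInsertions θ p q + Γ.rightInsertions θ p q := by
  rw [Γ.delta_suspendForms θ hp hq hζ hξ, AInfStructure.wheel, ← map_zsmul, ← map_zsmul,
    (Function.LeftInverse.injective desuspend_desuspend).eq_iff, add_assoc]
  constructor
  · intro h
    have h₁ := congrArg (fun f => ((-1 : ℤ) ^ p) • f) h
    simp only [smul_smul] at h₁
    rw [← pow_add, Even.neg_one_pow ⟨_, rfl⟩, one_smul, one_smul, sub_eq_iff_eq_add] at h₁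
    exact h₁
  · intro h
    rw [h, add_sub_cancel_right]

theorem AInfStructure.exists_extension_iff [FiniteDimensional k V] :
    (∃ S : WheeledAInfStructure 𝒱, S.toAInfStructure = Γ) ↔
      ∃ y ∈ Cyc 𝒱 0, Γ.delta 0 y = Γ.wheel := by
  constructor
  · rintro ⟨S, rfl⟩
    have hy : suspendForms 𝒱 S.θ ∈ Cyc 𝒱 0 := by
      intro p q
      by_cases h : p = 0 ∨ q = 0
      · have h₀ : suspendForms 𝒱 S.θ p q = 0 := by
          rw [suspendForms, S.θ_zero p q h, map_zero, smul_zero]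
        refine ⟨fun _ => h₀, ?_, ?_, ?_⟩
        · rw [h₀]
          exact fun _ _ _ _ => rfl
        · rw [h₀, map_zero]
        · rw [h₀, map_zero]
      · have hp : 1 ≤ p := by omega
        have hq : 1 ≤ q := by omega
        exact ⟨fun h' => absurd h' h, (suspendForms_homogeneous S.θ p q).2 (S.θ_degree p q hp hq),
          (permute_zeta_suspendForms hp S.θ).2 (S.θ_zeta p q hp hq),
          (permute_xi_suspendForms hq S.θ).2 (S.θ_xi p q hp hq)⟩
    refine ⟨_, hy, ?_⟩
    funext p q
    by_cases h : p = 0 ∨ q = 0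
    · rw [(S.wheel_mem_cyc p q).1 h]
      exact S.delta_eq_zero_of_zero 0 h _ fun p q => (hy p q).1
    · have hp : 1 ≤ p := by omega
      have hq : 1 ≤ q := by omega
      exact (S.differential_iff S.θ hp hq (hy p q).2.2.1 (hy p q).2.2.2).2
        (S.θ_differential p q hp hq)
  · rintro ⟨y, hy, hd⟩
    -- `suspendForms` is an involution, so every cochain arises from a family of forms on `V`.
    obtain ⟨θ, rfl⟩ : ∃ θ, y = suspendForms 𝒱 θ := ⟨_, (suspendForms_suspendForms y).symm⟩
    refine ⟨{ Γ with
      θ := θ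
      θ_zero := fun p q h => ?_
      θ_degree := fun p q _ _ => (suspendForms_homogeneous θ p q).1 (hy p q).2.1
      θ_zeta := fun p q hp _ => (permute_zeta_suspendForms hp θ).1 (hy p q).2.2.1
      θ_xi := fun p q _ hq => (permute_xi_suspendForms hq θ).1 (hy p q).2.2.2
      θ_differential := fun p q hp hq =>
        (Γ.differential_iff θ hp hq (hy p q).2.2.1 (hy p q).2.2.2).1
          (congrFun (congrFun hd p) q) }, rfl⟩
    rw [← suspendForms_suspendForms (𝒱 := 𝒱) θ, suspendForms, (hy p q).1 h, map_zero, smul_zero]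

end Graded

end

end WheeledAss

/-! ### Conclusion. -/

theorem theorem6p7p2 {k V : Type*} [Field k] [CharZero k] [AddCommGroup V] [Module k V]
    [FiniteDimensional k V] (𝒱 : ℤ → Submodule k V) [DirectSum.Decomposition 𝒱]
    (Γ : WheeledAss.AInfStructure 𝒱) :
    ∃ h : Γ.wheel ∈ Γ.cocycles 1,
      (∃ S : WheeledAss.WheeledAInfStructure 𝒱, S.toAInfStructure = Γ) ↔
        Γ.cohomologyClass 1 Γ.wheel h = 0 := by
  refine ⟨Γ.wheel_mem_cocycles, ?_⟩
  rw [Γ.exists_extension_iff, WheeledAss.AInfStructure.cohomologyClass,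
    Submodule.Quotient.mk_eq_zero]
  -- Membership in the coboundaries unfolds to a primitive in `Cyc 𝒱 (1 - 1)`, and `1 - 1` reduces
  -- to `0`.
  rfl
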